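/- Let $\varphi_0(z)=e^z$ and $\varphi_k(z)=\int_0^1 e^{(1-\theta)z}\frac{\theta^{k-1}}{(k-1)!}\,d\theta$ for $k\ge 1$. For a problem $u'=F(u)=Au+g(u)$, $u(t_0)=u_0$, an $s$-stage explicit exponential Runge--Kutta method with step size $h>0$ is $$U_{ni}=u_n+c_ih\varphi_1(c_ihA)F(u_n)+h\sum_{j=2}^{i-1}a_{ij}(hA)\bigl(g(U_{nj})-g(u_n)\bigr),\qquad 2\le i\le s,$$ $$u_{n+1}=u_n+h\varphi_1(hA)F(u_n)+h\sum_{i=2}^{s}b_i(hA)\bigl(g(U_{ni})-g(u_n)\bigr),$$ with nodes $c_i\ge 0$ and coefficients $a_{ij}(z),b_i(z)$ that are finite linear combinations of functions $\varphi_k(rz)$, $k\ge 0$, $r\ge 0$. (The expression $v+\tau\varphi_1(\tau A)F(v)$ is read as $e^{\tau A}v+\tau\varphi_1(\tau A)g(v)$, which is the same for $v$ in the domain of $A$.) The method is *of order 5* if it is convergent of order 5 for semilinear parabolic problems: for every complex Banach space $X$, every generator $A$ of an analytic semigroup on $X$, and every $g:X\to X$ and smooth solution $u:[t_0,T]\to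 X$ of $u'=Au+g(u)$ such that $g$ is infinitely often Fréchet differentiable with uniformly bounded derivatives in a strip along $u$, there are constants $C$ and $h_0>0$ such that $\|u_n-u(t_0+nh)\|\le Ch^5$ for all $0<h\le h_0$ and all $n\ge 0$ with $t_0+nh\le T$, where $u_0=u(t_0)$. The *stiff order conditions up to order four* are, with $\psi_{j,i}(Z)=\sum_{k=2}^{i-1}a_{ik}(Z)\frac{c_k^{j-1}}{(j-1)!}-c_i^j\varphi_j(c_iZ)$ and for all square complex matrices $Z,J,K$ of the same size: 1. $\sum_{i=2}^s b_i(Z)c_i=\varphi_2(Z)$; 2. $\sum_{i=2}^s b_i(Z)\frac{c_i^2}{2!}=\varphi_3(Z)$; 3. $\sum_{i=2}^s b_i(Z)J\psi_{2,i}(Z)=0$; 4. $\sum_{i=2}^s b_i(Z)\frac{c_i^3}{3!}=\varphi_4(Z)$; 5. $\sum_{i=2}^s b_i(Z)J\psi_{3,i}(Z)=0$; 6. $\sum_{i=2}^s b_i(Z)J\sum_{j=2}^{i-1}a_{ij}(Z)J\psi_{2,j}(Z)=0$; 7. $\sum_{i=2}^s b_i(Z)c_iK\psi_{2,i}(Z)=0$.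 **Theorem.** Let $s\le 6$. There is no explicit exponential Runge--Kutta method of order 5 with $s$ stages. Moreover, no explicit exponential Runge--Kutta method with $s$ stages satisfies all the stiff order conditions 1--7. -/

import Mathlib

open scoped ContDiff Topology NNReal

noncomputable section

namespace ExpRK

/-! ### Coefficient functions -/

/-- A coefficient function: a finite linear combination, with complex weights, of scaled functions
`z ↦ φ_k (r z)`, `k ∈ ℕ`, `r ≥ 0`. The weight of `z ↦ φ_k (r z)` is the value at `(k, r)`. -/
abbrev Coeff : Type := (ℕ × ℝ≥0) →₀ ℂ

/-- `φ_k` of a square matrix: `φ_0 (Z) = exp Z` and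
`φ_k (Z) = ∫₀¹ exp ((1 - θ) Z) θ^(k-1) / (k-1)! dθ` for `k ≥ 1` (entrywise integral). -/
def phiMatrix {d : ℕ} (k : ℕ) (Z : Matrix (Fin d) (Fin d) ℂ) : Matrix (Fin d) (Fin d) ℂ :=
  if k = 0 then NormedSpace.exp Z
  else Matrix.of fun p q =>
    ∫ θ in (0 : ℝ)..1,
      NormedSpace.exp (((1 - θ : ℝ) : ℂ) • Z) p q * ((θ ^ (k - 1) / (k - 1).factorial : ℝ) : ℂ)

/-- The value of a coefficient function at a square matrix. -/
def Coeff.atMatrix {d : ℕ} (f : Coeff) (Z : Matrix (Fin d) (Fin d) ℂ) :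
    Matrix (Fin d) (Fin d) ℂ :=
  f.sum fun p α => α • phiMatrix p.1 (((p.2 : ℝ) : ℂ) • Z)

section Semigroup

variable {X : Type*} [NormedAddCommGroup X] [NormedSpace ℂ X]

/-- `φ_k (t A) x` for the generator `A` of the semigroup `S t = exp (t A)`. -/
def phiSemigroup (S : ℝ → X →L[ℂ] X) (k : ℕ) (t : ℝ) (x : X) : X :=
  if k = 0 then S t x
  else ∫ θ in (0 : ℝ)..1, (θ ^ (k - 1) / (k - 1).factorial : ℝ) • S ((1 - θ) * t) x

/-- `f (h A) x` for a coefficient function `f` and the generator `A` of the semigroup `S`. -/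
def Coeff.atSemigroup (f : Coeff) (S : ℝ → X →L[ℂ] X) (h : ℝ) (x : X) : X :=
  f.sum fun p α => α • phiSemigroup S p.1 (p.2 * h) x

end Semigroup

/-! ### Methods and stiff order conditions -/

/-- The data of an explicit exponential Runge–Kutta method: nodes `c i`, and
coefficient functions `a i j`, `b i`. An `s`-stage method uses only
`c i`, `b i` for `2 ≤ i ≤ s` and `a i j` for `2 ≤ j < i ≤ s`. The coefficients belonging to the
first stage (`c 1 = 0`, `U 1 = u`) are eliminated. -/
structure Method where
  c : ℕ → ℝ≥0
  a : ℕ → ℕ → Coeff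
  b : ℕ → Coeff

namespace Method

/-- The node as a complex number. -/
def node (m : Method) (i : ℕ) : ℂ := ((m.c i : ℝ) : ℂ)

/-- `ψ_{j,i} (Z) = ∑_{k=2}^{i-1} a_{ik} (Z) c_k^{j-1} / (j-1)! - c_i^j φ_j (c_i Z)`. -/
def psi (m : Method) {d : ℕ} (j i : ℕ) (Z : Matrix (Fin d) (Fin d) ℂ) :
    Matrix (Fin d) (Fin d) ℂ :=
  (∑ k ∈ Finset.Ico 2 i, (m.node k ^ (j - 1) / ((j - 1).factorial : ℂ)) • (m.a i k).atMatrix Z)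
    - m.node i ^ j • phiMatrix j (m.node i • Z)

/-- The stiff order conditions up to order four of the `s`-stage method `m`, for
arbitrary square matrices `Z`, `J`, `K` of the same arbitrary size. -/
structure StiffOrderFour (m : Method) (s : ℕ) : Prop where
  cond1 : ∀ (d : ℕ) (Z : Matrix (Fin d) (Fin d) ℂ),
    ∑ i ∈ Finset.Icc 2 s, m.node i • (m.b i).atMatrix Z = phiMatrix 2 Z
  cond2 : ∀ (d : ℕ) (Z : Matrix (Fin d) (Fin d) ℂ),
    ∑ i ∈ Finset.Icc 2 s, (m.node i ^ 2 / 2) • (m.b i).atMatrix Z = phiMatrix 3 Z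
  cond3 : ∀ (d : ℕ) (Z J : Matrix (Fin d) (Fin d) ℂ),
    ∑ i ∈ Finset.Icc 2 s, (m.b i).atMatrix Z * J * m.psi 2 i Z = 0
  cond4 : ∀ (d : ℕ) (Z : Matrix (Fin d) (Fin d) ℂ),
    ∑ i ∈ Finset.Icc 2 s, (m.node i ^ 3 / 6) • (m.b i).atMatrix Z = phiMatrix 4 Z
  cond5 : ∀ (d : ℕ) (Z J : Matrix (Fin d) (Fin d) ℂ),
    ∑ i ∈ Finset.Icc 2 s, (m.b i).atMatrix Z * J * m.psi 3 i Z = 0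
  cond6 : ∀ (d : ℕ) (Z J : Matrix (Fin d) (Fin d) ℂ),
    ∑ i ∈ Finset.Icc 2 s, (m.b i).atMatrix Z * J *
      (∑ j ∈ Finset.Ico 2 i, (m.a i j).atMatrix Z * J * m.psi 2 j Z) = 0
  cond7 : ∀ (d : ℕ) (Z K : Matrix (Fin d) (Fin d) ℂ),
    ∑ i ∈ Finset.Icc 2 s, m.node i • ((m.b i).atMatrix Z * K * m.psi 2 i Z) = 0

end Method

/-! ### Semilinear parabolic problems -/

/-- The open sector of half-angle `δ` around the positive real axis. -/
def sector (δ : ℝ) : Set ℂ := {z | z ≠ 0 ∧ |z.arg| < δ}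

section Problem

variable {X : Type*} [NormedAddCommGroup X] [NormedSpace ℂ X]

/-- `S` (on `t ≥ 0`) is an analytic semigroup: it extends to a holomorphic, strongly
continuous semigroup on some sector around the positive real axis. -/
def IsAnalyticSemigroup (S : ℝ → X →L[ℂ] X) : Prop :=
  ∃ δ : ℝ, 0 < δ ∧ δ ≤ Real.pi / 2 ∧ ∃ E : ℂ → X →L[ℂ] X,
    (∀ t : ℝ, 0 ≤ t → E t = S t) ∧
    E 0 = 1 ∧
    (∀ z ∈ sector δ, ∀ w ∈ sector δ, E (z + w) = (E z).comp (E w)) ∧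
    DifferentiableOn ℂ E (sector δ) ∧
    ∀ x : X, Filter.Tendsto (fun z => E z x) (𝓝[sector δ] 0) (𝓝 x)

/-- `A` is the infinitesimal generator of `S`: its domain consists of exactly those `x` for which
`(S t x - x) / t` converges as `t ↓ 0`, and `A x` is the limit. -/
def IsGenerator (A : X →ₗ.[ℂ] X) (S : ℝ → X →L[ℂ] X) : Prop :=
  ∀ x y : X, (x, y) ∈ A.graph ↔
    Filter.Tendsto (fun t : ℝ => t⁻¹ • (S t x - x)) (𝓝[>] 0) (𝓝 y)

end Problem

/-- An initial value problem `u' = A u + g (u)`, `u (t₀) = u₀`, on `[t₀, T]` in the space `X`,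
together with its exact solution `u`, such that `A` generates an analytic semigroup, the solution
is smooth with values in `X`, and `g` is Fréchet smooth with uniformly
bounded derivatives in a strip along the exact solution. -/
structure ParabolicProblem (X : Type*) [NormedAddCommGroup X] [NormedSpace ℂ X] where
  /-- the linear operator, possibly unbounded -/
  A : X →ₗ.[ℂ] X
  /-- the semigroup `S t = exp (t A)` -/
  S : ℝ → X →L[ℂ] X
  /-- the nonlinearity -/
  g : X → X
  t₀ : ℝ
  T : ℝ
  /-- the exact solution -/
  u : ℝ → X
  lt : t₀ < T
  analytic : IsAnalyticSemigroup S
  generator : IsGenerator A S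
  smooth_u : ContDiffOn ℝ ∞ u (Set.Icc t₀ T)
  /-- `u t` lies in the domain of `A` and `u' t = A (u t) + g (u t)` -/
  solution : ∀ t ∈ Set.Icc t₀ T, (u t, derivWithin u (Set.Icc t₀ T) t - g (u t)) ∈ A.graph
  smooth_g : ∃ r : ℝ, 0 < r ∧
    ContDiffOn ℂ ∞ g (Metric.thickening r (u '' Set.Icc t₀ T)) ∧
    ∀ k : ℕ, ∃ B : ℝ, ∀ x ∈ Metric.thickening r (u '' Set.Icc t₀ T),
      ‖iteratedFDeriv ℂ k g x‖ ≤ B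

/-! ### The numerical scheme and its convergence -/

namespace Method

section Scheme

variable {X : Type*} [NormedAddCommGroup X] [NormedSpace ℂ X]

/-- The term `v + τ φ_1 (τ A) (A v + g (v))`. Since `τ φ_1 (τ A) A v = exp (τ A) v - v`, it equals
`exp (τ A) v + τ φ_1 (τ A) g (v)`, which is meaningful for every `v` in `X`. -/
def exponentialEuler (P : ParabolicProblem X) (τ : ℝ) (v : X) : X :=
  P.S τ v + τ • phiSemigroup P.S 1 τ (P.g v)

/-- The internal stages
`U_i = v + c_i h φ_1 (c_i h A) F (v) + h ∑_{j=2}^{i-1} a_{ij} (h A) (g (U_j) - g (v))`. -/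
def stage (m : Method) (P : ParabolicProblem X) (h : ℝ) (v : X) (i : ℕ) : X :=
  exponentialEuler P (m.c i * h) v +
    h • ∑ j : Finset.Ico 2 i,
      (m.a i j).atSemigroup P.S h (P.g (stage m P h v j.1) - P.g v)
termination_by i
decreasing_by exact (Finset.mem_Ico.mp j.2).2

/-- One step of the `s`-stage method, of size `h`, from `v`:
`v + h φ_1 (h A) F (v) + h ∑_{i=2}^{s} b_i (h A) (g (U_i) - g (v))`. -/
def step (m : Method) (s : ℕ) (P : ParabolicProblem X) (h : ℝ) (v : X) : X :=
  exponentialEuler P h v +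
    h • ∑ i ∈ Finset.Icc 2 s,
      (m.b i).atSemigroup P.S h (P.g (m.stage P h v i) - P.g v)

/-- The numerical solution after `n` steps of constant size `h`, from `u (t₀)`. -/
def numSol (m : Method) (s : ℕ) (P : ParabolicProblem X) (h : ℝ) (n : ℕ) : X :=
  (m.step s P h)^[n] (P.u P.t₀)

end Scheme

/-- The `s`-stage method `m` is convergent of order `p`: for every semilinear parabolic problem, the
error with constant step size `h` is bounded by `C h ^ p`, uniformly on `[t₀, T]`, with a constant
that depends neither on `n` nor on the (sufficiently small) step size. -/
def ConvergentOfOrder (m : Method) (s p : ℕ) : Prop :=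
  ∀ (X : Type) [NormedAddCommGroup X] [NormedSpace ℂ X] [CompleteSpace X]
    (P : ParabolicProblem X),
    ∃ C h₀ : ℝ, 0 < h₀ ∧ ∀ h : ℝ, 0 < h → h ≤ h₀ → ∀ n : ℕ, P.t₀ + n * h ≤ P.T →
      ‖m.numSol s P h n - P.u (P.t₀ + n * h)‖ ≤ C * h ^ p

end Method

end ExpRK

end

/-! Both assertions reduce to one set of scalar identities, `ScalarConditions`, in the values b_i(x)
and a_ij(y) at negative reals x and y. These identities are contradictory when only b_2, ..., b_6
are available.

The contradiction (`not_scalarConditions`): x enters the order conditions only through the b_i, so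
any finite combination L of point evaluations in x may be applied to them. Let L annihilate b_5 and
b_6, and put l_i = L(b_i). Of the inner coefficients there remain only r_2 = l_3 a_32 + l_4 a_42 and
r_3 = l_4 a_43. The nested condition is a constant-coefficient relation between them. If c_2 ≠ 0,
then r_2 is a constant multiple of r_3, so the functions Σ l_i c_i² φ_2(c_i y) and Σ l_i c_i³
φ_3(c_i y) are both multiples of r_3. Comparing Taylor coefficients yields a two-term recurrence for
the power sums of the c_i. It either degenerates or forces factorial growth, while power sums grow
at most geometrically; hence all positive moments Σ l_i c_i^n vanish (`moments_eq_zero`, which also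
covers c_2 = 0). By the quadrature conditions L then annihilates φ_2, φ_3 and φ_4. So these three
linearly independent functions lie in the span of b_5 and b_6, which is absurd.

The reductions: stiff order conditions give the scalar ones through diagonal Z and matrix units J.
For convergence, only the first step is used, whose error must be O(h⁵). A diagonal operator on null
sequences has eigenvalues y(k+1)², and the step size is h = (k+1)⁻², so that component k always sees
hμ = y. Its error is a fixed defect times h^q/(k+1) with q ≤ 4, and letting k → ∞ kills the defect.
-/

namespace ExpRK

/-! ### Scalar `φ`-functions -/

/-- The scalar function `φ_k`. -/
noncomputable def phi (k : ℕ) (z : ℂ) : ℂ :=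
  if k = 0 then Complex.exp z
  else ∫ θ in (0 : ℝ)..1,
    Complex.exp (((1 - θ : ℝ) : ℂ) * z) * ((θ ^ (k - 1) / (k - 1).factorial : ℝ) : ℂ)

theorem phi_zero (z : ℂ) : phi 0 z = Complex.exp z := by simp [phi]

theorem phi_succ (k : ℕ) (z : ℂ) : phi (k + 1) z =
    ∫ θ in (0 : ℝ)..1, Complex.exp (((1 - θ : ℝ) : ℂ) * z) * ((θ ^ k / k.factorial : ℝ) : ℂ) := by
  simp [phi]

theorem phi_apply_zero (k : ℕ) : phi k 0 = 1 / (k.factorial : ℂ) := by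
  cases k with
  | zero => simp [phi_zero]
  | succ k =>
    have h : ∫ θ in (0 : ℝ)..1, (θ ^ k / k.factorial : ℝ) = 1 / (k + 1).factorial := by
      rw [intervalIntegral.integral_div, integral_pow]
      simp [Nat.factorial_succ]
      field_simp
    rw [phi_succ]
    simp only [mul_zero, Complex.exp_zero, one_mul]
    rw [intervalIntegral.integral_ofReal, h]
    push_cast
    rfl

theorem hasDerivAt_exp_one_sub_mul (z : ℂ) (θ : ℝ) :
    HasDerivAt (fun θ : ℝ => Complex.exp (((1 - θ : ℝ) : ℂ) * z))
      (-(z * Complex.exp (((1 - θ : ℝ) : ℂ) * z))) θ := by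
  have h := (((hasDerivAt_id θ).const_sub 1).ofReal_comp.mul_const z).cexp
  convert! h using 1
  simp
  ring

/-- Integration by parts, written as the fundamental theorem of calculus for e^{(1-θ)z} θ^k/k!. -/
theorem mul_phi_succ (k : ℕ) (z : ℂ) : z * phi (k + 1) z = phi k z - 1 / (k.factorial : ℂ) := by
  cases k with
  | zero =>
    have h := intervalIntegral.integral_eq_sub_of_hasDerivAt (a := 0) (b := 1)
      (fun θ _ => hasDerivAt_exp_one_sub_mul z θ)
      (Continuous.intervalIntegrable (by fun_prop) _ _)
    rw [intervalIntegral.integral_neg, intervalIntegral.integral_const_mul] at h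
    rw [phi_succ, phi_zero]
    simp at h ⊢
    linear_combination -h
  | succ k =>
    have hd : ∀ θ : ℝ, HasDerivAt (fun θ : ℝ => Complex.exp (((1 - θ : ℝ) : ℂ) * z) *
        ((θ ^ (k + 1) / (k + 1).factorial : ℝ) : ℂ))
        (-(z * (Complex.exp (((1 - θ : ℝ) : ℂ) * z) *
          ((θ ^ (k + 1) / (k + 1).factorial : ℝ) : ℂ))) +
          Complex.exp (((1 - θ : ℝ) : ℂ) * z) * ((θ ^ k / k.factorial : ℝ) : ℂ)) θ := by
      intro θ
      have h1 : HasDerivAt (fun θ : ℝ => θ ^ (k + 1) / (k + 1).factorial)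
          (θ ^ k / k.factorial) θ := by
        convert! (hasDerivAt_pow (k + 1) θ).div_const ((k + 1).factorial : ℝ) using 1
        rw [Nat.factorial_succ]
        push_cast
        field_simp
      convert! (hasDerivAt_exp_one_sub_mul z θ).mul h1.ofReal_comp using 1
      ring
    have h := intervalIntegral.integral_eq_sub_of_hasDerivAt (a := 0) (b := 1)
      (fun θ _ => hd θ) (Continuous.intervalIntegrable (by fun_prop) _ _)
    rw [intervalIntegral.integral_add (Continuous.intervalIntegrable (by fun_prop) _ _)
      (Continuous.intervalIntegrable (by fun_prop) _ _),
      intervalIntegral.integral_neg, intervalIntegral.integral_const_mul, ← phi_succ,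
      ← phi_succ] at h
    simp at h ⊢
    linear_combination -h

theorem hasSum_phi (k : ℕ) (z : ℂ) :
    HasSum (fun n : ℕ => z ^ n / ((n + k).factorial : ℂ)) (phi k z) := by
  by_cases hz : z = 0
  · subst hz
    rw [phi_apply_zero]
    have h := hasSum_single (f := fun n : ℕ => (0 : ℂ) ^ n / ((n + k).factorial : ℂ)) 0
      fun n hn => by simp [hn]
    simpa using h
  induction k with
  | zero =>
    rw [phi_zero, Complex.exp_eq_exp_ℂ]
    simpa using NormedSpace.expSeries_div_hasSum_exp z
  | succ k ih =>
    have h := (hasSum_nat_add_iff' 1).mpr ih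
    simp only [Finset.range_one, Finset.sum_singleton, pow_zero, zero_add] at h
    rw [← mul_phi_succ] at h
    have h2 := h.mul_left z⁻¹
    rw [inv_mul_cancel_left₀ hz] at h2
    convert! h2 using 2 with n
    rw [show n + 1 + k = n + (k + 1) by ring]
    field_simp
    ring

/-- A power series that converges to zero on the negative half-line has zero coefficients. -/
theorem eq_zero_of_hasSum_zero {f : ℕ → ℂ}
    (h : ∀ y : ℝ, y < 0 → HasSum (fun n => f n * (y : ℂ) ^ n) 0) (n : ℕ) : f n = 0 := by
  have hs : ∀ z ∈ Metric.ball (0 : ℂ) 1, Summable fun n => z ^ n • f n := by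
    intro z hz
    -- Convergence at -1 bounds the coefficients, so the series converges on the unit disc and the
    -- identity theorem applies at 0.
    have hb : Filter.Tendsto (fun n => f n * ((-1 : ℝ) : ℂ) ^ n) Filter.atTop (𝓝 0) :=
      (h (-1) (by norm_num)).summable.tendsto_atTop_zero
    obtain ⟨C, hC⟩ := hb.norm.bddAbove_range
    have hz1 : ‖z‖ < 1 := by simpa using hz
    refine Summable.of_norm_bounded ((summable_geometric_of_lt_one (norm_nonneg z) hz1).mul_left C)
      fun n => ?_
    have hn : ‖f n‖ ≤ C := by simpa using hC ⟨n, rfl⟩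
    rw [norm_smul, norm_pow, mul_comm]
    gcongr
  have hp : HasFPowerSeriesAt (fun z => ∑' n, z ^ n • f n)
      (FormalMultilinearSeries.ofScalars ℂ f) 0 := by
    rw [hasFPowerSeriesAt_iff]
    filter_upwards [Metric.ball_mem_nhds (0 : ℂ) one_pos] with z hz
    simpa using (hs z hz).hasSum
  have hfreq : ∃ᶠ z in 𝓝[≠] (0 : ℂ), (∑' n, z ^ n • f n) = 0 := by
    have ht : Filter.Tendsto (fun y : ℝ => (y : ℂ)) (𝓝[<] 0) (𝓝[≠] (0 : ℂ)) := by
      refine tendsto_nhdsWithin_iff.mpr ⟨?_, ?_⟩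
      · exact (Complex.continuous_ofReal.tendsto' 0 0 (by simp)).mono_left nhdsWithin_le_nhds
      · filter_upwards [self_mem_nhdsWithin] with y hy
        simpa using ne_of_lt hy
    refine ht.frequently (Filter.Eventually.frequently ?_)
    filter_upwards [self_mem_nhdsWithin] with y hy
    simpa [mul_comm] using (h y hy).tsum_eq
  have hev := hp.analyticAt.frequently_zero_iff_eventually_zero.mp hfreq
  have := hp.eq_zero_of_eventually hev
  have h0 := congrArg (fun p => p.coeff n) this
  rw [FormalMultilinearSeries.coeff_ofScalars] at h0
  exact h0

/-! ### The algebraic core -/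

/-- If all power sums with exponent at least two vanish, then so does the first one. -/
theorem sum_mul_eq_zero_of_forall_pow {ι : Type*} (s : Finset ι) (l c : ι → ℂ)
    (h : ∀ n : ℕ, ∑ i ∈ s, l i * c i ^ (n + 2) = 0) : ∑ i ∈ s, l i * c i = 0 := by
  classical
  -- On the finite set of nodes 1/x is a polynomial p, so c = c² p(c) is a combination of powers
  -- with exponent at least two. At a zero node both sides vanish whatever the value of p.
  let p := Lagrange.interpolate (s.image c) id fun x => x⁻¹
  have hp : ∀ i ∈ s, p.eval (c i) = (c i)⁻¹ := fun i hi =>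
    Lagrange.eval_interpolate_at_node (v := id) _ Function.injective_id.injOn
      (Finset.mem_image_of_mem c hi)
  have h1 : ∑ i ∈ s, l i * c i = ∑ i ∈ s, l i * (c i ^ 2 * p.eval (c i)) := by
    refine Finset.sum_congr rfl fun i hi => ?_
    rw [hp i hi]
    by_cases hc : c i = 0
    · simp [hc]
    · field_simp
  rw [h1]
  simp only [Polynomial.eval_eq_sum_range, Finset.mul_sum]
  rw [Finset.sum_comm]
  refine Finset.sum_eq_zero fun n _ => ?_
  calc ∑ i ∈ s, l i * (c i ^ 2 * (p.coeff n * c i ^ n))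
      = p.coeff n * ∑ i ∈ s, l i * c i ^ (n + 2) := by
        rw [Finset.mul_sum]
        exact Finset.sum_congr rfl fun i _ => by ring
    _ = 0 := by rw [h n, mul_zero]

/-- Power sums cannot grow factorially. -/
theorem eq_zero_of_factorial_growth {ι : Type*} (s : Finset ι) (l c : ι → ℂ) {κ : ℂ} (hκ : κ ≠ 0)
    (h : ∀ n : ℕ, ∑ i ∈ s, l i * c i ^ (n + 1) = κ * (n + 3) * ∑ i ∈ s, l i * c i ^ n) (n : ℕ) :
    ∑ i ∈ s, l i * c i ^ n = 0 := by
  set G : ℕ → ℂ := fun n => ∑ i ∈ s, l i * c i ^ n with hG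
  have hGr : ∀ n, G (n + 1) = κ * (n + 3) * G n := h
  have hlow : ∀ n : ℕ, ‖κ‖ ^ n * n.factorial * ‖G 0‖ ≤ ‖G n‖ := by
    intro n
    induction n with
    | zero => simp
    | succ n ih =>
      rw [hGr, norm_mul, norm_mul]
      have h3 : ((n : ℝ) + 1) ≤ ‖(n : ℂ) + 3‖ := by
        have : ‖(n : ℂ) + 3‖ = (n : ℝ) + 3 := by
          rw [show (n : ℂ) + 3 = ((n + 3 : ℕ) : ℂ) by push_cast; ring, Complex.norm_natCast]
          push_cast; ring
        rw [this]; linarith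
      calc ‖κ‖ ^ (n + 1) * (n + 1).factorial * ‖G 0‖
          = ‖κ‖ * (n + 1) * (‖κ‖ ^ n * n.factorial * ‖G 0‖) := by
            rw [Nat.factorial_succ]; push_cast; ring
        _ ≤ ‖κ‖ * ‖(n : ℂ) + 3‖ * ‖G n‖ := by gcongr
  set M : ℝ := ∑ i ∈ s, ‖c i‖ with hM
  have hup : ∀ n : ℕ, ‖G n‖ ≤ (∑ i ∈ s, ‖l i‖) * M ^ n := by
    intro n
    rw [Finset.sum_mul]
    refine (norm_sum_le _ _).trans (Finset.sum_le_sum fun i hi => ?_)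
    rw [norm_mul, norm_pow]
    gcongr
    exact Finset.single_le_sum (f := fun i => ‖c i‖) (fun _ _ => norm_nonneg _) hi
  have hκ' : 0 < ‖κ‖ := norm_pos_iff.mpr hκ
  have h0 : G 0 = 0 := by
    have hle : ∀ n : ℕ, ‖G 0‖ ≤ (∑ i ∈ s, ‖l i‖) * ((M / ‖κ‖) ^ n / n.factorial) := by
      intro n
      have := (hlow n).trans (hup n)
      have hpos : 0 < ‖κ‖ ^ n * n.factorial := by positivity
      rw [div_pow, div_div, ← mul_div_assoc, le_div_iff₀ hpos, mul_comm ‖G 0‖]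
      exact this
    have ht := (FloorSemiring.tendsto_pow_div_factorial_atTop (M / ‖κ‖)).const_mul
      (∑ i ∈ s, ‖l i‖)
    rw [mul_zero] at ht
    exact norm_le_zero_iff.mp (ge_of_tendsto' ht hle)
  induction n with
  | zero => exact h0
  | succ n ih =>
    change G (n + 1) = 0
    rw [hGr]
    rw [show G n = 0 from ih, mul_zero]

theorem hasSum_sum_mul_phi {ι : Type*} (s : Finset ι) (l c : ι → ℂ) (k : ℕ) (y : ℂ) :
    HasSum (fun n : ℕ => (∑ i ∈ s, l i * c i ^ (n + k)) / ((n + k).factorial : ℂ) * y ^ n)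
      (∑ i ∈ s, l i * (c i ^ k * phi k (c i * y))) := by
  have h := hasSum_sum (s := s) fun i _ => (hasSum_phi k (c i * y)).mul_left (l i * c i ^ k)
  convert! h using 1
  · funext n
    rw [Finset.sum_div, Finset.sum_mul]
    exact Finset.sum_congr rfl fun i _ => by ring
  · exact Finset.sum_congr rfl fun i _ => by ring

/-- The order conditions satisfied by three weights `l i` force all positive moments to vanish. -/
theorem moments_eq_zero {ι : Type*} (s : Finset ι) (l c : ι → ℂ) (c₂ c₃ v₃ : ℂ) (r₂ r₃ : ℝ → ℂ)
    (h₂ : ∀ y : ℝ, y < 0 → r₂ y * c₂ + r₃ y * c₃ = ∑ i ∈ s, l i * (c i ^ 2 * phi 2 (c i * y)))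
    (h₃ : ∀ y : ℝ, y < 0 → r₂ y * (c₂ ^ 2 / 2) + r₃ y * (c₃ ^ 2 / 2) =
      ∑ i ∈ s, l i * (c i ^ 3 * phi 3 (c i * y)))
    (h : ∀ y : ℝ, y < 0 → r₂ y * (-(c₂ ^ 2 / 2)) + r₃ y * v₃ = 0)
    (hv : c₂ = 0 → v₃ = -(c₃ ^ 2 / 2)) (n : ℕ) : ∑ i ∈ s, l i * c i ^ (n + 1) = 0 := by
  set G : ℕ → ℂ := fun n => ∑ i ∈ s, l i * c i ^ (n + 2) with hG
  suffices hG0 : ∀ n, G n = 0 by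
    cases n with
    | zero => simpa using sum_mul_eq_zero_of_forall_pow s l c hG0
    | succ n => exact hG0 n
  have of_zero : (∀ y : ℝ, y < 0 → ∑ i ∈ s, l i * (c i ^ 2 * phi 2 (c i * y)) = 0) →
      ∀ n, G n = 0 := by
    intro h0 n
    have := eq_zero_of_hasSum_zero (fun y hy => h0 y hy ▸ hasSum_sum_mul_phi s l c 2 (y : ℂ)) n
    simpa [Nat.factorial_ne_zero] using this
  -- Here the nested relation reads r₃ c₃² = 0, so the left side of `h₂` vanishes.
  by_cases hc : c₂ = 0
  · refine of_zero fun y hy => ?_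
    have h1 := h y hy
    rw [hv hc, hc] at h1
    rw [← h₂ y hy, hc]
    have : r₃ y * c₃ = 0 := by
      rcases eq_or_ne c₃ 0 with h0 | h0
      · simp [h0]
      · have : r₃ y * (c₃ ^ 2) = 0 := by linear_combination -2 * h1
        rcases mul_eq_zero.mp this with h2 | h2
        · simp [h2]
        · exact absurd h2 (pow_ne_zero 2 h0)
    rw [this]; ring
  obtain ⟨ρ, hρ⟩ : ∃ ρ : ℂ, ∀ y : ℝ, y < 0 → r₂ y = ρ * r₃ y :=
    ⟨2 * v₃ / c₂ ^ 2, fun y hy => by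
      have := h y hy
      field_simp
      linear_combination -2 * this⟩
  set P' : ℂ := ρ * c₂ + c₃ with hP'
  set P : ℂ := ρ * (c₂ ^ 2 / 2) + c₃ ^ 2 / 2 with hP
  have hne3 : ∀ n : ℕ, (n + 3 : ℂ) ≠ 0 := fun n => by
    have : ((n + 3 : ℕ) : ℂ) ≠ 0 := Nat.cast_ne_zero.mpr (Nat.succ_ne_zero _)
    simpa using this
  -- By `h₂` and `h₃` the φ_2-sum is P' r₃ and the φ_3-sum is P r₃. Cross-multiplication eliminates
  -- r₃, and the factor n + 3 is (n+3)!/(n+2)!.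
  have hrec : ∀ n : ℕ, P * (n + 3) * G n = P' * G (n + 1) := by
    intro n
    have key := eq_zero_of_hasSum_zero
      (f := fun n : ℕ => P * ((∑ i ∈ s, l i * c i ^ (n + 2)) / ((n + 2).factorial : ℂ)) -
        P' * ((∑ i ∈ s, l i * c i ^ (n + 3)) / ((n + 3).factorial : ℂ))) (fun y hy => by
      have e1 := (hasSum_sum_mul_phi s l c 2 (y : ℂ)).mul_left P
      have e2 := (hasSum_sum_mul_phi s l c 3 (y : ℂ)).mul_left P'
      have e3 := e1.sub e2
      rw [← h₂ y hy, ← h₃ y hy, hρ y hy] at e3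
      convert! e3 using 1
      · funext n; ring
      · rw [hP, hP']; ring) n
    have hf : ((n + 3).factorial : ℂ) = (n + 3) * ((n + 2).factorial : ℂ) := by
      rw [Nat.factorial_succ]; push_cast; ring
    have hne : ((n + 2).factorial : ℂ) ≠ 0 := by exact_mod_cast Nat.factorial_ne_zero _
    have hne3 := hne3 n
    simp only [hf] at key
    field_simp at key
    rw [hG]
    linear_combination key
  by_cases hP'0 : P' = 0
  · refine of_zero fun y hy => ?_
    rw [← h₂ y hy, hρ y hy]
    linear_combination r₃ y * hP'0
  by_cases hP0 : P = 0
  · have hsucc : ∀ n, G (n + 1) = 0 := fun n => by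
      have := hrec n
      rw [hP0, zero_mul, zero_mul, eq_comm] at this
      exact (mul_eq_zero.mp this).resolve_left hP'0
    intro n
    cases n with
    | zero =>
      -- The recurrence leaves G 0 free; interpolation with the weights l i * c i recovers it from
      -- the higher power sums.
      have := sum_mul_eq_zero_of_forall_pow s (fun i => l i * c i) c fun n => by
        rw [← hsucc n, hG]
        exact Finset.sum_congr rfl fun i _ => by ring
      rw [← this, hG]
      exact Finset.sum_congr rfl fun i _ => by ring
    | succ n => exact hsucc n
  · intro n
    have hg : ∀ n, G n = ∑ i ∈ s, l i * c i ^ 2 * c i ^ n := fun n =>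
      Finset.sum_congr rfl fun i _ => by ring
    rw [hg]
    refine eq_zero_of_factorial_growth s (fun i => l i * c i ^ 2) c (κ := P / P')
      (div_ne_zero hP0 hP'0) (fun n => ?_) n
    rw [← hg, ← hg]
    field_simp
    linear_combination -hrec n

/-! ### Scalar order conditions and the dimension count -/

/-- The scalar version of `Method.psi`. -/
noncomputable def scalarPsi (c : ℕ → ℂ) (a : ℕ → ℕ → ℂ → ℂ) (j i : ℕ) (z : ℂ) : ℂ :=
  (∑ k ∈ Finset.Ico 2 i, c k ^ (j - 1) / ((j - 1).factorial : ℂ) * a i k z)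
    - c i ^ j * phi j (c i * z)

/-- The scalar consequences of the stiff order conditions, on the negative half-line. -/
structure ScalarConditions (c : ℕ → ℂ) (a : ℕ → ℕ → ℂ → ℂ) (b : ℕ → ℂ → ℂ) (s : ℕ) : Prop where
  quadrature : ∀ m ∈ Finset.Icc 1 3, ∀ x : ℝ, x < 0 →
    ∑ i ∈ Finset.Icc 2 s, b i x * (c i ^ m / (m.factorial : ℂ)) = phi (m + 1) x
  stages : ∀ j ∈ Finset.Icc 2 3, ∀ x y : ℝ, x < 0 → y < 0 →
    ∑ i ∈ Finset.Icc 2 s, b i x * scalarPsi c a j i y = 0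
  nested : ∀ x y : ℝ, x < 0 → y < 0 →
    ∑ i ∈ Finset.Icc 2 s, b i x * ∑ j ∈ Finset.Ico 2 i, a i j y * scalarPsi c a 2 j 0 = 0

/-- Padding with zero weights makes the number of stages exactly six in the main argument. -/
theorem ScalarConditions.extend {c : ℕ → ℂ} {a : ℕ → ℕ → ℂ → ℂ} {b : ℕ → ℂ → ℂ} {s t : ℕ}
    (h : ScalarConditions c a b s) (hst : s ≤ t) :
    ScalarConditions c a (fun i z => if i ≤ s then b i z else 0) t := by
  have key : ∀ (x : ℂ) (F : ℕ → ℂ), ∑ i ∈ Finset.Icc 2 t, (if i ≤ s then b i x else 0) * F i =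
      ∑ i ∈ Finset.Icc 2 s, b i x * F i := by
    intro x F
    rw [← Finset.sum_subset (Finset.Icc_subset_Icc_right hst)]
    · exact Finset.sum_congr rfl fun i hi => by rw [if_pos (Finset.mem_Icc.mp hi).2]
    · intro i hi hi'
      rw [if_neg, zero_mul]
      intro his
      exact hi' (Finset.mem_Icc.mpr ⟨(Finset.mem_Icc.mp hi).1, his⟩)
  exact ⟨fun m hm x hx => (key _ _).trans (h.quadrature m hm x hx),
    fun j hj x y hx hy => (key _ _).trans (h.stages j hj x y hx hy),
    fun x y hx hy => (key _ _).trans (h.nested x y hx hy)⟩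

theorem linearIndependent_phi :
    LinearIndependent ℂ fun (m : Fin 3) (x : {x : ℝ // x < 0}) => phi (m + 2) (x : ℝ) := by
  rw [Fintype.linearIndependent_iff]
  intro α hα
  have hs : ∀ x : ℝ, x < 0 → HasSum (fun n : ℕ => (∑ m : Fin 3, α m / ((n + (m + 2)).factorial : ℂ))
      * (x : ℂ) ^ n) 0 := by
    intro x hx
    have h := hasSum_sum (s := Finset.univ) fun (m : Fin 3) _ =>
      (hasSum_phi (m + 2) (x : ℂ)).mul_left (α m)
    have h0 := congrFun hα ⟨x, hx⟩
    simp only [Finset.sum_apply, Pi.smul_apply, smul_eq_mul, Pi.zero_apply] at h0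
    rw [h0] at h
    convert! h using 1
    funext n
    rw [Finset.sum_mul]
    exact Finset.sum_congr rfl fun m _ => by ring
  have h := eq_zero_of_hasSum_zero hs
  have e0 := h 0
  have e1 := h 1
  have e2 := h 2
  simp only [Fin.sum_univ_three] at e0 e1 e2
  norm_num [Nat.factorial] at e0 e1 e2
  -- The multipliers invert the 3 × 3 matrix with entries 1/(n+m+2)! of Taylor coefficients.
  have a0 : α 0 = 0 := by linear_combination 12 * e0 - 120 * e1 + 360 * e2
  have a1 : α 1 = 0 := by linear_combination 120 * e1 - 24 * e0 - 8 * a0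
  have a2 : α 2 = 0 := by linear_combination 24 * e0 - 12 * a0 - 4 * a1
  intro i
  fin_cases i
  · exact a0
  · exact a1
  · exact a2

/-- No coefficients with at most five internal stages satisfy the scalar conditions. -/
theorem not_scalarConditions {c : ℕ → ℂ} {a : ℕ → ℕ → ℂ → ℂ} {b : ℕ → ℂ → ℂ} {s : ℕ} (hs : s ≤ 6)
    (h : ScalarConditions c a b s) : False := by
  replace h := h.extend hs
  generalize (fun i z => if i ≤ s then b i z else 0) = b at h
  clear hs
  classical
  -- Functions of x are viewed as functionals on finite combinations of point evaluations; span
  -- membership can then be tested on common kernels.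
  let ev : ({x : ℝ // x < 0} → ℂ) →ₗ[ℂ] ({x : ℝ // x < 0} →₀ ℂ) →ₗ[ℂ] ℂ :=
    (Finsupp.llift ℂ ℂ ℂ {x : ℝ // x < 0}).toLinearMap
  have ev_inj : Function.Injective ev := (Finsupp.llift ℂ ℂ ℂ {x : ℝ // x < 0}).injective
  let B : ℕ → {x : ℝ // x < 0} → ℂ := fun i x => b i (x : ℝ)
  let F : Fin 3 → {x : ℝ // x < 0} → ℂ := fun m x => phi (m + 2) (x : ℝ)
  have hsum : ∀ (f : ℕ → ℂ), (fun x : {x : ℝ // x < 0} => ∑ i ∈ Finset.Icc 2 6, b i (x : ℝ) * f i) =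
      ∑ i ∈ Finset.Icc 2 6, f i • B i := by
    intro f
    funext x
    simp [B, mul_comm]
  have key : ∀ L, ev (B 5) L = 0 → ev (B 6) L = 0 → ∀ m, ev (F m) L = 0 := by
    intro L h5 h6
    have hL : ∀ f : ℕ → ℂ,
        ev (fun x : {x : ℝ // x < 0} => ∑ i ∈ Finset.Icc 2 6, b i (x : ℝ) * f i) L =
        ∑ i ∈ Finset.Icc 2 4, ev (B i) L * f i := by
      intro f
      rw [hsum, map_sum, LinearMap.sum_apply]
      have e : Finset.Icc 2 6 = insert 6 (insert 5 (Finset.Icc 2 4)) := by decide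
      rw [e, Finset.sum_insert (by decide), Finset.sum_insert (by decide)]
      simp only [map_smul, LinearMap.smul_apply, h5, h6, smul_eq_mul, mul_zero, zero_add]
      exact Finset.sum_congr rfl fun i _ => mul_comm _ _
    have hL0 : ∀ f : ℕ → ℂ, (∀ x : ℝ, x < 0 → ∑ i ∈ Finset.Icc 2 6, b i x * f i = 0) →
        ∑ i ∈ Finset.Icc 2 4, ev (B i) L * f i = 0 := by
      intro f hf
      rw [← hL]
      have : (fun x : {x : ℝ // x < 0} => ∑ i ∈ Finset.Icc 2 6, b i (x : ℝ) * f i) = 0 :=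
        funext fun x => hf x x.2
      rw [this, map_zero, LinearMap.zero_apply]
    have hI : Finset.Icc 2 4 = {2, 3, 4} := by decide
    have hI3 : Finset.Ico 2 3 = {2} := by decide
    have hI4 : Finset.Ico 2 4 = {2, 3} := by decide
    have s2 := fun y hy => hL0 _ fun x hx => h.stages 2 (by decide) x y hx hy
    have s3 := fun y hy => hL0 _ fun x hx => h.stages 3 (by decide) x y hx hy
    have sn := fun y hy => hL0 _ fun x hx => h.nested x y hx hy
    have hm := moments_eq_zero (Finset.Icc 2 4) (fun i => ev (B i) L) c (c 2) (c 3)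
      (scalarPsi c a 2 3 0)
      (fun y => ev (B 3) L * a 3 2 y + ev (B 4) L * a 4 2 y) (fun y => ev (B 4) L * a 4 3 y)
      (fun y hy => by
        have := s2 y hy
        simp [hI, hI3, hI4, scalarPsi] at this ⊢
        linear_combination this)
      (fun y hy => by
        have := s3 y hy
        simp [hI, hI3, hI4, scalarPsi] at this ⊢
        linear_combination this)
      (fun y hy => by
        have := sn y hy
        have h2 : scalarPsi c a 2 2 0 = -(c 2 ^ 2 / 2) := by
          simp [scalarPsi, phi_apply_zero]
          ring
        simp [hI, hI3, hI4, h2] at this ⊢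
        linear_combination this)
      (fun h0 => by
        simp [scalarPsi, hI3, h0, phi_apply_zero, div_eq_mul_inv])
    intro m
    have hF : F m = fun x : {x : ℝ // x < 0} =>
        ∑ i ∈ Finset.Icc 2 6, b i (x : ℝ) * (c i ^ (m.1 + 1) / ((m.1 + 1).factorial : ℂ)) :=
      funext fun x => (h.quadrature (m.1 + 1) (Finset.mem_Icc.mpr ⟨by omega, by omega⟩) x x.2).symm
    rw [hF, hL]
    have := hm m.1
    calc _ = (∑ i ∈ Finset.Icc 2 4, ev (B i) L * c i ^ (m.1 + 1)) / ((m.1 + 1).factorial : ℂ) := by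
          rw [Finset.sum_div]
          exact Finset.sum_congr rfl fun i _ => by ring
      _ = 0 := by rw [this, zero_div]
  let T : Fin 2 → ({x : ℝ // x < 0} →₀ ℂ) →ₗ[ℂ] ℂ := ![ev (B 5), ev (B 6)]
  have hspan : ∀ m, ev (F m) ∈ Submodule.span ℂ (Set.range T) := by
    intro m
    refine mem_span_of_iInf_ker_le_ker fun L hL => ?_
    rw [Submodule.mem_iInf] at hL
    exact key L (hL 0) (hL 1) m
  have hli : LinearIndependent ℂ fun m => ev (F m) :=
    linearIndependent_phi.map' ev (LinearMap.ker_eq_bot.mpr ev_inj)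
  have hcard := linearIndependent_le_span' (fun m => ev (F m)) hli (Set.range T)
    (Set.range_subset_iff.mpr hspan)
  have h2 : Fintype.card (Set.range T) ≤ 2 := by
    simpa using Fintype.card_range_le T
  rw [Cardinal.mk_fin] at hcard
  have h3 : 3 ≤ Fintype.card (Set.range T) := by exact_mod_cast hcard
  omega

/-! ### Diagonal matrices -/

/-- The value of a coefficient function at a complex number. -/
noncomputable def Coeff.val (f : Coeff) (z : ℂ) : ℂ :=
  f.sum fun p α => α * phi p.1 (((p.2 : ℝ) : ℂ) * z)

theorem phiMatrix_diagonal {d : ℕ} (k : ℕ) (v : Fin d → ℂ) :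
    phiMatrix k (Matrix.diagonal v) = Matrix.diagonal fun p => phi k (v p) := by
  have hexp : ∀ w : Fin d → ℂ, NormedSpace.exp (Matrix.diagonal w) =
      Matrix.diagonal fun p => Complex.exp (w p) := by
    intro w
    rw [Matrix.exp_diagonal]
    congr 1
    funext p
    rw [Pi.coe_exp, Complex.exp_eq_exp_ℂ]
  rcases k with _ | k
  · simp [phiMatrix, hexp, phi_zero]
  · ext p q
    simp only [phiMatrix, ← Matrix.diagonal_smul, hexp, Nat.add_eq_zero_iff, one_ne_zero,
      and_false, if_false, Matrix.of_apply, Nat.add_sub_cancel]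
    rcases eq_or_ne p q with rfl | hpq
    · simp [phi_succ]
    · simp [Matrix.diagonal_apply_ne _ hpq]

theorem Coeff.atMatrix_diagonal {d : ℕ} (f : Coeff) (v : Fin d → ℂ) :
    f.atMatrix (Matrix.diagonal v) = Matrix.diagonal fun p => f.val (v p) := by
  simp only [Coeff.atMatrix, ← Matrix.diagonal_smul, phiMatrix_diagonal]
  ext p q
  simp only [Finsupp.sum, Matrix.sum_apply]
  rcases eq_or_ne p q with rfl | hpq
  · simp [Coeff.val, Finsupp.sum]
  · simp [Matrix.diagonal_apply_ne _ hpq]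

theorem Method.psi_diagonal (m : Method) {d : ℕ} (j i : ℕ) (v : Fin d → ℂ) :
    m.psi j i (Matrix.diagonal v) =
      Matrix.diagonal fun p => scalarPsi m.node (fun i k => (m.a i k).val) j i (v p) := by
  simp only [Method.psi, ← Matrix.diagonal_smul, phiMatrix_diagonal, Coeff.atMatrix_diagonal]
  ext p q
  rcases eq_or_ne p q with rfl | hpq
  · simp [scalarPsi, Matrix.sum_apply]
  · simp [Matrix.diagonal_apply_ne _ hpq, Matrix.sum_apply]

/-- A matrix unit J between two diagonal factors decouples their arguments: for Z = diag(x, y),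
entry (0, 1) of b(Z) J ψ(Z) is b(x) ψ(y). The nested condition uses diag(x, y, 0) and a path 0 → 1 →
2. -/
theorem Method.StiffOrderFour.scalarConditions {m : Method} {s : ℕ} (h : m.StiffOrderFour s) :
    ScalarConditions m.node (fun i k => (m.a i k).val) (fun i => (m.b i).val) s where
  quadrature k hk x _ := by
    have e : ∀ (κ : ℕ → ℂ) (k : ℕ),
        ∑ i ∈ Finset.Icc 2 s, κ i • (m.b i).atMatrix (Matrix.diagonal fun _ : Fin 1 => (x : ℂ)) =
          phiMatrix k (Matrix.diagonal fun _ : Fin 1 => (x : ℂ)) →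
        ∑ i ∈ Finset.Icc 2 s, (m.b i).val x * κ i = phi k x := by
      intro κ k hk
      have := congrFun (congrFun hk 0) 0
      simpa [Coeff.atMatrix_diagonal, phiMatrix_diagonal, Matrix.sum_apply, mul_comm] using this
    rw [Finset.mem_Icc] at hk
    obtain ⟨h1, h3⟩ := hk
    interval_cases k
    · simpa using e m.node 2 (h.cond1 1 _)
    · simpa using e _ 3 (h.cond2 1 _)
    · simpa [Nat.factorial] using e _ 4 (h.cond4 1 _)
  stages j hj x y _ _ := by
    have e : ∀ j : ℕ,
        ∑ i ∈ Finset.Icc 2 s, (m.b i).atMatrix (Matrix.diagonal ![(x : ℂ), y]) *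
          Matrix.single 0 1 1 * m.psi j i (Matrix.diagonal ![(x : ℂ), y]) = 0 →
        ∑ i ∈ Finset.Icc 2 s, (m.b i).val x *
          scalarPsi m.node (fun i k => (m.a i k).val) j i y = 0 := by
      intro j hj
      have := congrFun (congrFun hj 0) 1
      simpa [Coeff.atMatrix_diagonal, Method.psi_diagonal, Matrix.sum_apply,
        Matrix.single_apply] using this
    rw [Finset.mem_Icc] at hj
    obtain ⟨h2, h3⟩ := hj
    interval_cases j
    · exact e 2 (h.cond3 2 _ _)
    · exact e 3 (h.cond5 2 _ _)
  nested x y _ _ := by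
    have := congrFun (congrFun (h.cond6 3 (Matrix.diagonal ![(x : ℂ), y, 0])
      (Matrix.single 0 1 1 + Matrix.single 1 2 1)) 0) 2
    simpa [Coeff.atMatrix_diagonal, Method.psi_diagonal, Matrix.sum_apply, Matrix.mul_apply,
      Fin.sum_univ_three, Matrix.single_apply, Matrix.diagonal_apply] using this

open scoped ZeroAtInfty BoundedContinuousFunction

/-! ### Diagonal semigroups on spaces of null families -/

section Diagonal

variable {ι : Type*} [TopologicalSpace ι]

theorem c0_norm_le {x : C₀(ι, ℂ)} {C : ℝ} (hC : 0 ≤ C) : ‖x‖ ≤ C ↔ ∀ n, ‖x n‖ ≤ C := by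
  rw [← ZeroAtInftyContinuousMap.norm_toBCF_eq_norm, BoundedContinuousFunction.norm_le hC]
  rfl

theorem c0_norm_apply_le (x : C₀(ι, ℂ)) (n : ι) : ‖x n‖ ≤ ‖x‖ :=
  (c0_norm_le (norm_nonneg x)).mp le_rfl n

/-- Evaluation at a point. -/
noncomputable def c0Eval (n : ι) : C₀(ι, ℂ) →L[ℂ] ℂ :=
  LinearMap.mkContinuous ⟨⟨fun x => x n, fun _ _ => rfl⟩, fun _ _ => rfl⟩ 1 fun x => by
    simpa using c0_norm_apply_le x n

@[simp] theorem c0Eval_apply (n : ι) (x : C₀(ι, ℂ)) : c0Eval n x = x n := rfl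

theorem c0_sum_apply {α : Type*} (s : Finset α) (f : α → C₀(ι, ℂ)) (n : ι) :
    (∑ i ∈ s, f i) n = ∑ i ∈ s, f i n :=
  map_sum (c0Eval n) f s

/-- Multiplication of null families by bounded families. -/
noncomputable def diagOp : (ι →ᵇ ℂ) →L[ℂ] C₀(ι, ℂ) →L[ℂ] C₀(ι, ℂ) :=
  LinearMap.mkContinuous₂
    (LinearMap.mk₂ ℂ (fun (m : ι →ᵇ ℂ) (x : C₀(ι, ℂ)) =>
      (⟨⟨fun n => m n * x n, m.continuous.mul (map_continuous x)⟩, by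
        refine squeeze_zero_norm (a := fun n => ‖m‖ * ‖x n‖) (fun n => ?_) ?_
        · simp only [norm_mul]
          gcongr
          exact m.norm_coe_le_norm n
        · simpa using (ZeroAtInftyContinuousMapClass.zero_at_infty x).norm.const_mul ‖m‖⟩ :
        C₀(ι, ℂ)))
      (fun m m' x => ZeroAtInftyContinuousMap.ext fun n => add_mul (m n) (m' n) (x n))
      (fun r m x => ZeroAtInftyContinuousMap.ext fun n => mul_assoc r (m n) (x n))
      (fun m x x' => ZeroAtInftyContinuousMap.ext fun n => mul_add (m n) (x n) (x' n))
      (fun r m x => ZeroAtInftyContinuousMap.ext fun n => mul_left_comm (m n) r (x n)))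
    1 fun m x => by
      rw [one_mul, c0_norm_le (by positivity)]
      intro n
      change ‖m n * x n‖ ≤ _
      rw [norm_mul]
      exact mul_le_mul (m.norm_coe_le_norm n) (c0_norm_apply_le x n) (norm_nonneg _)
        (norm_nonneg _)

@[simp] theorem diagOp_apply (m : ι →ᵇ ℂ) (x : C₀(ι, ℂ)) (n : ι) :
    diagOp m x n = m n * x n := rfl

/-- The graph of the diagonal operator with the eigenvalues `μ`. -/
def diagGraph (μ : ι → ℝ) : Submodule ℂ (C₀(ι, ℂ) × C₀(ι, ℂ)) where
  carrier := {p | ∀ n, p.2 n = μ n * p.1 n}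
  add_mem' {p q} hp hq n := by
    have := hp n
    have := hq n
    simp_all [mul_add]
  zero_mem' n := by simp
  smul_mem' r p hp n := by
    have := hp n
    simp_all [mul_left_comm]

/-- The diagonal operator with the eigenvalues `μ`, on its maximal domain. -/
noncomputable def diagGenerator (μ : ι → ℝ) : C₀(ι, ℂ) →ₗ.[ℂ] C₀(ι, ℂ) :=
  (diagGraph μ).toLinearPMap

theorem mem_graph_diagGenerator {μ : ι → ℝ} {x y : C₀(ι, ℂ)} :
    (x, y) ∈ (diagGenerator μ).graph ↔ ∀ n, y n = μ n * x n := by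
  rw [diagGenerator, Submodule.toLinearPMap_graph_eq]
  · rfl
  · rintro ⟨x, y⟩ h rfl
    ext n
    simpa using h n

variable [DiscreteTopology ι]

/-- A null family is small off a finite set, where boundedness of the multipliers suffices; on the
finite set pointwise convergence is uniform. -/
theorem tendsto_diagOp_apply {α : Type*} {l : Filter α} {m : α → ι →ᵇ ℂ} {m₀ : ι →ᵇ ℂ}
    (hb : ∀ᶠ a in l, ‖m a‖ ≤ 1) (hb₀ : ‖m₀‖ ≤ 1)
    (hm : ∀ n, Filter.Tendsto (fun a => m a n) l (𝓝 (m₀ n))) (x : C₀(ι, ℂ)) :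
    Filter.Tendsto (fun a => diagOp (m a) x) l (𝓝 (diagOp m₀ x)) := by
  rw [Metric.tendsto_nhds]
  intro ε hε
  have hx : ∀ᶠ n in Filter.cofinite, ‖x n‖ < ε / 4 := by
    rw [← Filter.cocompact_eq_cofinite]
    simpa using (ZeroAtInftyContinuousMapClass.zero_at_infty x).norm.eventually
      (gt_mem_nhds (show ‖(0 : ℂ)‖ < ε / 4 by simpa using (by positivity : 0 < ε / 4)))
  have hfin : ∀ᶠ a in l, ∀ n ∈ {n | ¬ ‖x n‖ < ε / 4}, ‖m a n * x n - m₀ n * x n‖ < ε / 2 := by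
    refine (Filter.eventually_all_finite (Filter.eventually_cofinite.mp hx)).mpr fun n _ => ?_
    have h := ((hm n).mul_const (x n)).sub_const (m₀ n * x n) |>.norm
    rw [sub_self, norm_zero] at h
    exact h.eventually (gt_mem_nhds (by positivity))
  filter_upwards [hfin, hb] with a ha hba
  rw [dist_eq_norm]
  refine lt_of_le_of_lt ((c0_norm_le (by positivity : 0 ≤ ε / 2)).mpr fun n => ?_)
    (by linarith : ε / 2 < ε)
  rw [ZeroAtInftyContinuousMap.sub_apply, diagOp_apply, diagOp_apply]
  by_cases hn : ‖x n‖ < ε / 4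
  · calc ‖m a n * x n - m₀ n * x n‖ ≤ ‖m a n * x n‖ + ‖m₀ n * x n‖ := norm_sub_le _ _
      _ ≤ 1 * (ε / 4) + 1 * (ε / 4) := by
        rw [norm_mul, norm_mul]
        gcongr
        · exact ((m a).norm_coe_le_norm n).trans hba
        · exact (m₀.norm_coe_le_norm n).trans hb₀
      _ = ε / 2 := by ring
  · exact (ha n hn).le

/-- The multiplier `exp (z μ)`, reflected to the right half-plane. -/
noncomputable def expMult (μ : ι → ℝ) (hμ : ∀ n, μ n ≤ 0) (z : ℂ) : ι →ᵇ ℂ :=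
  BoundedContinuousFunction.ofNormedAddCommGroupDiscrete
    (fun n => Complex.exp (μ n * (|z.re| + z.im * Complex.I))) 1 fun n => by
      rw [Complex.norm_exp]
      simpa using mul_nonpos_of_nonpos_of_nonneg (hμ n) (abs_nonneg z.re)

variable {μ : ι → ℝ} {hμ : ∀ n, μ n ≤ 0}

theorem expMult_apply {z : ℂ} (hz : 0 ≤ z.re) (n : ι) :
    expMult μ hμ z n = Complex.exp (μ n * z) := by
  change Complex.exp (μ n * (|z.re| + z.im * Complex.I)) = _
  rw [abs_of_nonneg hz, Complex.re_add_im]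

theorem norm_expMult_le (z : ℂ) : ‖expMult μ hμ z‖ ≤ 1 := by
  refine (BoundedContinuousFunction.norm_le zero_le_one).mpr fun n => ?_
  change ‖Complex.exp (μ n * (|z.re| + z.im * Complex.I))‖ ≤ 1
  rw [Complex.norm_exp]
  simpa using mul_nonpos_of_nonpos_of_nonneg (hμ n) (abs_nonneg z.re)

theorem continuous_expMult_apply (n : ι) : Continuous fun z => expMult μ hμ z n := by
  change Continuous fun z : ℂ => Complex.exp (μ n * (|z.re| + z.im * Complex.I))
  fun_prop

/-- The diagonal semigroup with the eigenvalues `μ`. -/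
noncomputable def diagSemigroup (μ : ι → ℝ) (hμ : ∀ n, μ n ≤ 0) (t : ℝ) :
    C₀(ι, ℂ) →L[ℂ] C₀(ι, ℂ) := diagOp (expMult μ hμ t)

theorem diagSemigroup_apply {t : ℝ} (ht : 0 ≤ t) (x : C₀(ι, ℂ)) (n : ι) :
    diagSemigroup μ hμ t x n = Complex.exp (t * μ n) * x n := by
  rw [diagSemigroup, diagOp_apply, expMult_apply (by simpa using ht), mul_comm (t : ℂ)]

theorem continuous_diagSemigroup_apply (x : C₀(ι, ℂ)) :
    Continuous fun t => diagSemigroup μ hμ t x :=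
  continuous_iff_continuousAt.mpr fun t => tendsto_diagOp_apply
    (.of_forall fun _ => norm_expMult_le _) (norm_expMult_le _)
    (fun n => ((continuous_expMult_apply n).comp Complex.continuous_ofReal).tendsto t) x

theorem sq_mul_exp_neg_le {x ρ : ℝ} (hx : 0 ≤ x) (hρ : 0 < ρ) :
    x ^ 2 * Real.exp (-(x * (ρ / 2))) ≤ 8 / ρ ^ 2 := by
  have h := Real.quadratic_le_exp_of_nonneg (x := x * (ρ / 2)) (by positivity)
  rw [Real.exp_neg, ← div_eq_mul_inv, div_le_div_iff₀ (Real.exp_pos _) (by positivity)]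
  have : 0 ≤ x * (ρ / 2) := by positivity
  nlinarith

/-- The constant is uniform in ν, which gives holomorphy in operator norm. Half of the decay e^{ν Re
z} absorbs the exponential in the Taylor remainder, the other half absorbs ν². -/
theorem norm_exp_mul_sub_sub_le {ν : ℝ} (hν : ν ≤ 0) {z w : ℂ} (hz : 0 < z.re)
    (hw : ‖w - z‖ ≤ z.re / 2) :
    ‖Complex.exp (ν * w) - Complex.exp (ν * z) - (w - z) * (ν * Complex.exp (ν * z))‖ ≤
      8 / z.re ^ 2 * ‖w - z‖ ^ 2 := by
  have h := Complex.norm_exp_sub_sum_le_norm_mul_exp ((ν : ℂ) * (w - z)) 2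
  have e : Complex.exp (ν * w) - Complex.exp (ν * z) - (w - z) * (ν * Complex.exp (ν * z)) =
      Complex.exp (ν * z) * (Complex.exp (ν * (w - z)) -
        ∑ m ∈ Finset.range 2, (ν * (w - z)) ^ m / (m.factorial : ℂ)) := by
    rw [show (ν : ℂ) * w = ν * z + ν * (w - z) by ring, Complex.exp_add]
    simp [Finset.sum_range_succ]
    ring
  rw [e, norm_mul, Complex.norm_exp]
  have hre : ((ν : ℂ) * z).re = -(-ν * z.re) := by simp
  have hn : ‖(ν : ℂ) * (w - z)‖ = -ν * ‖w - z‖ := by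
    rw [norm_mul, Complex.norm_real, Real.norm_of_nonpos hν]
  rw [hn] at h
  rw [hre]
  calc Real.exp (-(-ν * z.re)) * ‖_‖
      ≤ Real.exp (-(-ν * z.re)) * ((-ν * ‖w - z‖) ^ 2 * Real.exp (-ν * (z.re / 2))) := by
        gcongr
        refine h.trans ?_
        gcongr
        linarith
    _ = ((-ν) ^ 2 * Real.exp (-(-ν * (z.re / 2)))) * ‖w - z‖ ^ 2 := by
        rw [show -(-ν * (z.re / 2)) = -(-ν * z.re) + -ν * (z.re / 2) by ring, Real.exp_add]
        ring
    _ ≤ _ := by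
        gcongr
        exact sq_mul_exp_neg_le (by linarith) hz

theorem differentiableAt_expMult {z : ℂ} (hz : 0 < z.re) :
    DifferentiableAt ℂ (expMult μ hμ) z := by
  have hbound : ∀ n, ‖(μ n : ℂ) * Complex.exp (μ n * z)‖ ≤ 1 / z.re := by
    intro n
    rw [norm_mul, Complex.norm_exp, Complex.norm_real, Real.norm_of_nonpos (hμ n)]
    have hre : ((μ n : ℂ) * z).re = -(-μ n * z.re) := by simp
    rw [hre, Real.exp_neg, ← div_eq_mul_inv, div_le_div_iff₀ (Real.exp_pos _) hz, one_mul]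
    linarith [Real.add_one_le_exp (-μ n * z.re)]
  let D : ι →ᵇ ℂ := BoundedContinuousFunction.ofNormedAddCommGroupDiscrete
    (fun n => (μ n : ℂ) * Complex.exp (μ n * z)) (1 / z.re) hbound
  refine HasDerivAt.differentiableAt (f' := D) ?_
  rw [hasDerivAt_iff_isLittleO]
  refine Asymptotics.IsBigO.trans_isLittleO (g := fun w => ‖w - z‖ ^ 2) ?_
    (Asymptotics.isLittleO_pow_sub_sub z one_lt_two)
  refine Asymptotics.IsBigO.of_bound (8 / z.re ^ 2) ?_
  filter_upwards [Metric.closedBall_mem_nhds z (half_pos hz)] with w hw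
  rw [mem_closedBall_iff_norm] at hw
  rw [norm_pow, norm_norm, BoundedContinuousFunction.norm_le (by positivity)]
  intro n
  have hwre : 0 ≤ w.re := by
    have h1 := (Complex.abs_re_le_norm (w - z)).trans hw
    rw [Complex.sub_re] at h1
    linarith [(abs_le.mp h1).1]
  have := norm_exp_mul_sub_sub_le (hμ n) hz hw
  rw [← expMult_apply (hμ := hμ) hwre, ← expMult_apply (hμ := hμ) hz.le] at this
  have hD : D n = μ n * expMult μ hμ z n := by rw [expMult_apply hz.le]; rfl
  rw [← hD] at this
  exact this

theorem mem_sector_pi_div_two {z : ℂ} : z ∈ sector (Real.pi / 2) ↔ 0 < z.re := by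
  rw [sector, Set.mem_ofPred_eq, Complex.abs_arg_lt_pi_div_two_iff]
  constructor
  · rintro ⟨h0, h | h⟩
    · exact h
    · exact absurd h h0
  · intro h
    exact ⟨fun h0 => by simp [h0] at h, Or.inl h⟩

theorem isAnalyticSemigroup_diagSemigroup : IsAnalyticSemigroup (diagSemigroup μ hμ) := by
  refine ⟨Real.pi / 2, by positivity, le_rfl, fun z => diagOp (expMult μ hμ z),
    fun t _ => rfl, ?_, ?_, ?_, ?_⟩
  · ext x n
    simp [expMult_apply]
  · intro z hz w hw
    rw [mem_sector_pi_div_two] at hz hw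
    ext x n
    simp only [diagOp_apply, ContinuousLinearMap.comp_apply]
    rw [expMult_apply (by simpa using (add_pos hz hw).le), expMult_apply hz.le,
      expMult_apply hw.le, mul_add, Complex.exp_add, mul_assoc]
  · intro z hz
    rw [mem_sector_pi_div_two] at hz
    have hd : DifferentiableAt ℂ (fun m : ι →ᵇ ℂ => diagOp m) (expMult μ hμ z) :=
      ContinuousLinearMap.differentiableAt _
    exact (hd.comp z (differentiableAt_expMult hz)).differentiableWithinAt
  · intro x
    have h := tendsto_diagOp_apply (l := 𝓝[sector (Real.pi / 2)] 0) (m := expMult μ hμ)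
      (m₀ := expMult μ hμ 0)
      (.of_forall fun _ => norm_expMult_le _) (norm_expMult_le _)
      (fun n => ((continuous_expMult_apply n).tendsto 0).mono_left nhdsWithin_le_nhds) x
    convert! h using 2
    ext n
    simp [expMult_apply]

theorem continuous_phi (k : ℕ) : Continuous (phi k) := by
  cases k with
  | zero => simpa only [funext phi_zero] using! Complex.continuous_exp
  | succ k =>
    rw [funext (phi_succ k)]
    exact intervalIntegral.continuous_parametric_intervalIntegral_of_continuous'
      (by fun_prop) _ _

theorem norm_phi_one_le {x : ℝ} (hx : x ≤ 0) : ‖phi 1 x‖ ≤ 1 := by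
  rw [phi_succ]
  refine (intervalIntegral.norm_integral_le_of_norm_le_const (C := 1) fun θ hθ => ?_).trans
    (by simp)
  rw [Set.uIoc_of_le zero_le_one] at hθ
  simp only [pow_zero, Nat.factorial_zero, Nat.cast_one, div_one, Complex.ofReal_one, mul_one]
  rw [Complex.norm_exp, Real.exp_le_one_iff, ← Complex.ofReal_mul, Complex.ofReal_re]
  exact mul_nonpos_of_nonneg_of_nonpos (by linarith [hθ.2]) hx

/-- On the maximal domain the difference quotient is φ_1(tμ) applied to y = μx, and |φ_1| ≤ 1 on the
negative axis. The converse is read off componentwise. -/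
theorem isGenerator_diagGenerator : IsGenerator (diagGenerator μ) (diagSemigroup μ hμ) := by
  intro x y
  rw [mem_graph_diagGenerator]
  constructor
  · intro h
    let η : ℝ → ι →ᵇ ℂ := fun t => BoundedContinuousFunction.ofNormedAddCommGroupDiscrete
      (fun n => phi 1 ((|t| * μ n : ℝ) : ℂ)) 1 fun n =>
        norm_phi_one_le (mul_nonpos_of_nonneg_of_nonpos (abs_nonneg t) (hμ n))
    have hη : ∀ t n, η t n = phi 1 ((|t| * μ n : ℝ) : ℂ) := fun _ _ => rfl
    have hη1 : ∀ t, ‖η t‖ ≤ 1 := fun t =>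
      BoundedContinuousFunction.norm_ofNormedAddCommGroup_le _ zero_le_one _
    have ht := tendsto_diagOp_apply (l := 𝓝[>] (0 : ℝ)) (m := η) (m₀ := η 0)
      (.of_forall hη1) (hη1 0) (fun n => by
        simp only [hη]
        have hc : Continuous fun t : ℝ => phi 1 ((|t| * μ n : ℝ) : ℂ) :=
          (continuous_phi 1).comp (by fun_prop)
        exact (hc.tendsto 0).mono_left nhdsWithin_le_nhds) y
    have h0 : diagOp (η 0) y = y := by
      ext n
      simp [hη, phi_apply_zero]
    rw [h0] at ht
    refine ht.congr' ?_
    filter_upwards [self_mem_nhdsWithin] with t ht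
    have ht' : 0 < t := ht
    ext n
    have hp := mul_phi_succ 0 ((t * μ n : ℝ) : ℂ)
    rw [phi_zero] at hp
    simp only [ZeroAtInftyContinuousMap.smul_apply, ZeroAtInftyContinuousMap.sub_apply,
      diagSemigroup_apply ht'.le, diagOp_apply, hη, abs_of_pos ht', h n, Complex.real_smul]
    push_cast at hp ⊢
    have htc : (t : ℂ) ≠ 0 := by exact_mod_cast ht'.ne'
    field_simp
    simp at hp
    linear_combination x n * hp
  · intro h n
    have h1 := ((c0Eval n).continuous.tendsto y).comp h
    have h2 : Filter.Tendsto (fun t : ℝ => t⁻¹ • (Complex.exp (t * μ n) * x n - x n)) (𝓝[>] 0)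
        (𝓝 (μ n * x n)) := by
      have hd : HasDerivAt (fun t : ℝ => Complex.exp (t * μ n) * x n) (μ n * x n) 0 := by
        have := (((Complex.ofRealCLM.hasDerivAt (x := 0)).mul_const (μ n : ℂ)).cexp).mul_const (x n)
        simpa using this
      have := hd.tendsto_slope_zero_right
      simpa using this
    refine tendsto_nhds_unique (h1.congr' ?_) h2
    filter_upwards [self_mem_nhdsWithin] with t ht
    have ht' : 0 < t := ht
    simp [diagSemigroup_apply ht'.le]

theorem phiSemigroup_diagSemigroup_apply (k : ℕ) {t : ℝ} (ht : 0 ≤ t) (x : C₀(ι, ℂ)) (n : ι) :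
    phiSemigroup (diagSemigroup μ hμ) k t x n = phi k (t * μ n) * x n := by
  cases k with
  | zero => simp [phiSemigroup, phi_zero, diagSemigroup_apply ht]
  | succ k =>
    have hc : Continuous fun θ : ℝ => (θ ^ k / k.factorial : ℝ) •
        diagSemigroup μ hμ ((1 - θ) * t) x := by
      have h1 : Continuous fun θ : ℝ => diagSemigroup μ hμ ((1 - θ) * t) x :=
        (continuous_diagSemigroup_apply x).comp
          (by fun_prop : Continuous fun θ : ℝ => (1 - θ) * t)
      fun_prop
    have h := (c0Eval n).intervalIntegral_comp_comm
      (hc.intervalIntegrable (μ := MeasureTheory.volume) 0 1)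
    simp only [phiSemigroup, Nat.add_eq_zero_iff, one_ne_zero, and_false, if_false,
      Nat.add_sub_cancel]
    rw [← c0Eval_apply, ← h, phi_succ, ← intervalIntegral.integral_mul_const]
    refine intervalIntegral.integral_congr fun θ hθ => ?_
    rw [Set.uIcc_of_le zero_le_one] at hθ
    have hθt : 0 ≤ (1 - θ) * t := mul_nonneg (by linarith [hθ.2]) ht
    simp only [c0Eval_apply, ZeroAtInftyContinuousMap.smul_apply, diagSemigroup_apply hθt,
      Complex.real_smul]
    push_cast
    ring_nf

theorem Coeff.atSemigroup_diagSemigroup_apply (f : Coeff) {h : ℝ} (hh : 0 ≤ h) (x : C₀(ι, ℂ))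
    (n : ι) : f.atSemigroup (diagSemigroup μ hμ) h x n = f.val (h * μ n) * x n := by
  rw [Coeff.atSemigroup, Finsupp.sum, c0_sum_apply, Coeff.val, Finsupp.sum, Finset.sum_mul]
  refine Finset.sum_congr rfl fun p _ => ?_
  rw [ZeroAtInftyContinuousMap.smul_apply,
    phiSemigroup_diagSemigroup_apply _ (by positivity)]
  simp only [smul_eq_mul]
  push_cast
  ring_nf

end Diagonal

/-! ### One step of a method for a diagonal problem -/

section Step

variable {ι : Type*} [TopologicalSpace ι] [DiscreteTopology ι] {μ : ι → ℝ} {hμ : ∀ n, μ n ≤ 0}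

theorem exponentialEuler_apply {P : ParabolicProblem C₀(ι, ℂ)} (hP : P.S = diagSemigroup μ hμ)
    {τ : ℝ} (hτ : 0 ≤ τ) (v : C₀(ι, ℂ)) (n : ι) :
    Method.exponentialEuler P τ v n =
      Complex.exp (τ * μ n) * v n + τ * (phi 1 (τ * μ n) * P.g v n) := by
  rw [Method.exponentialEuler, ZeroAtInftyContinuousMap.add_apply,
    ZeroAtInftyContinuousMap.smul_apply, hP, diagSemigroup_apply hτ,
    phiSemigroup_diagSemigroup_apply 1 hτ, Complex.real_smul]

theorem stage_apply (m : Method) {P : ParabolicProblem C₀(ι, ℂ)} (hP : P.S = diagSemigroup μ hμ)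
    {h : ℝ} (hh : 0 ≤ h) (v : C₀(ι, ℂ)) (i : ℕ) (n : ι) :
    m.stage P h v i n = Complex.exp (m.node i * (h * μ n)) * v n +
      m.node i * h * (phi 1 (m.node i * (h * μ n)) * P.g v n) +
      h * ∑ j ∈ Finset.Ico 2 i,
        (m.a i j).val (h * μ n) * (P.g (m.stage P h v j) n - P.g v n) := by
  rw [Method.stage, ZeroAtInftyContinuousMap.add_apply, ZeroAtInftyContinuousMap.smul_apply,
    exponentialEuler_apply hP (by positivity),
    Finset.sum_coe_sort (Finset.Ico 2 i) fun j =>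
      (m.a i j).atSemigroup P.S h (P.g (m.stage P h v j) - P.g v),
    c0_sum_apply, Complex.real_smul]
  simp only [hP, Coeff.atSemigroup_diagSemigroup_apply _ hh,
    ZeroAtInftyContinuousMap.sub_apply, Method.node, Complex.ofReal_mul, mul_assoc]

theorem step_apply (m : Method) (s : ℕ) {P : ParabolicProblem C₀(ι, ℂ)}
    (hP : P.S = diagSemigroup μ hμ) {h : ℝ} (hh : 0 ≤ h) (v : C₀(ι, ℂ)) (n : ι) :
    m.step s P h v n = Complex.exp (h * μ n) * v n + h * (phi 1 (h * μ n) * P.g v n) +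
      h * ∑ i ∈ Finset.Icc 2 s,
        (m.b i).val (h * μ n) * (P.g (m.stage P h v i) n - P.g v n) := by
  rw [Method.step, ZeroAtInftyContinuousMap.add_apply, ZeroAtInftyContinuousMap.smul_apply,
    exponentialEuler_apply hP hh, c0_sum_apply, Complex.real_smul]
  simp only [hP, Coeff.atSemigroup_diagSemigroup_apply _ hh,
    ZeroAtInftyContinuousMap.sub_apply]

end Step

/-! ### Null families -/

section Families

variable {ι κ : Type*} [TopologicalSpace ι] [DiscreteTopology ι] [TopologicalSpace κ]
  [DiscreteTopology κ]

/-- The unit families. -/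
noncomputable def c0Single [DecidableEq ι] (i : ι) : C₀(ι, ℂ) where
  toFun := Pi.single i 1
  continuous_toFun := continuous_of_discreteTopology
  zero_at_infty' := by
    rw [Filter.cocompact_eq_cofinite]
    refine tendsto_const_nhds.congr' ?_
    filter_upwards [(Set.finite_singleton i).compl_mem_cofinite] with n hn
    exact (Pi.single_eq_of_ne (M := fun _ => ℂ) hn 1).symm

theorem c0Single_apply [DecidableEq ι] (i n : ι) :
    c0Single i n = (Pi.single i 1 : ι → ℂ) n := rfl

/-- Reindexing of null families along a partially defined injective map, extended by zero. -/
noncomputable def c0Pull (σ : ι → Option κ)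
    (hσ : ∀ n n' k, σ n = some k → σ n' = some k → n = n') : C₀(κ, ℂ) →L[ℂ] C₀(ι, ℂ) :=
  LinearMap.mkContinuous
    { toFun := fun x =>
        { toFun := fun n => (σ n).elim 0 x
          continuous_toFun := continuous_of_discreteTopology
          zero_at_infty' := by
            rw [Filter.cocompact_eq_cofinite, Metric.tendsto_nhds]
            intro ε hε
            have hx : ∀ᶠ k in Filter.cofinite, ‖x k‖ < ε := by
              rw [← Filter.cocompact_eq_cofinite]
              simpa using (ZeroAtInftyContinuousMapClass.zero_at_infty x).norm.eventually
                (gt_mem_nhds (show ‖(0 : ℂ)‖ < ε by simpa using hε))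
            rw [Filter.eventually_cofinite] at hx ⊢
            refine (hx.biUnion fun k _ => Set.Subsingleton.finite
              (s := {n | σ n = some k}) fun n hn n' hn' => hσ n n' k hn hn').subset ?_
            intro n hn
            cases hk : σ n with
            | none => exact absurd hn (by simp [hk, hε])
            | some k =>
              refine Set.mem_biUnion (x := k) ?_ hk
              simpa [hk] using hn }
      map_add' := fun x y => by
        ext n
        change (σ n).elim 0 (x + y) = (σ n).elim 0 x + (σ n).elim 0 y
        cases σ n <;> simp
      map_smul' := fun r x => by
        ext n
        change (σ n).elim 0 (r • x) = r * (σ n).elim 0 x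
        cases σ n <;> simp }
    1 fun x => by
      rw [one_mul, c0_norm_le (norm_nonneg x)]
      intro n
      change ‖(σ n).elim 0 x‖ ≤ ‖x‖
      cases σ n with
      | none => simp
      | some k => exact c0_norm_apply_le x k

end Families

/-! ### The test problems -/

/-- The nonlinear part depends on u only through the scalar τ u, which stays in a compact disc even
though bounded sets of X are not relatively compact. -/
theorem exists_bound_iteratedFDeriv {X : Type*} [NormedAddCommGroup X] [NormedSpace ℂ X]
    {G : ℂ → X} (hG : ContDiff ℂ ∞ G) (τ : X →L[ℂ] ℂ) (Λ : X →L[ℂ] X) {s : Set X}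
    (hs : Bornology.IsBounded s) (k : ℕ) :
    ∃ B : ℝ, ∀ x ∈ s, ‖iteratedFDeriv ℂ k (fun u => G (τ u) + Λ u) x‖ ≤ B := by
  have hGk : ContDiff ℂ k G := hG.of_le (by exact_mod_cast le_top)
  obtain ⟨R, hR⟩ := hs.exists_norm_le
  obtain ⟨B₁, hB₁⟩ := (isCompact_closedBall (0 : ℂ) (‖τ‖ * R)).exists_bound_of_continuousOn
    (hG.continuous_iteratedFDeriv (m := k) (by exact_mod_cast le_top)).continuousOn
  have h1 : ∀ x ∈ s, ‖iteratedFDeriv ℂ k (fun u => G (τ u)) x‖ ≤ B₁ * ‖τ‖ ^ k := by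
    intro x hx
    have e := τ.iteratedFDeriv_comp_right hGk x (i := k) le_rfl
    change ‖iteratedFDeriv ℂ k (G ∘ τ) x‖ ≤ _
    rw [e]
    refine (ContinuousMultilinearMap.norm_compContinuousLinearMap_le _ _).trans ?_
    rw [Finset.prod_const, Finset.card_univ, Fintype.card_fin]
    gcongr
    refine hB₁ _ ?_
    rw [mem_closedBall_zero_iff]
    exact (τ.le_opNorm x).trans (by gcongr; exact hR x hx)
  have h2 : ∃ B₂, ∀ x ∈ s, ‖iteratedFDeriv ℂ k (fun u => Λ u) x‖ ≤ B₂ := by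
    rcases k with _ | k
    · refine ⟨‖Λ‖ * R, fun x hx => ?_⟩
      rw [norm_iteratedFDeriv_zero]
      exact (Λ.le_opNorm x).trans (by gcongr; exact hR x hx)
    · have hf : fderiv ℂ (fun u => Λ u) = fun _ => Λ := funext fun x => Λ.fderiv
      refine ⟨‖Λ‖, fun x _ => ?_⟩
      rw [← norm_iteratedFDeriv_fderiv, hf]
      rcases k with _ | k
      · rw [norm_iteratedFDeriv_zero]
      · rw [iteratedFDeriv_const_of_ne k.succ_ne_zero]
        simp
  obtain ⟨B₂, hB₂⟩ := h2
  refine ⟨B₁ * ‖τ‖ ^ k + B₂, fun x hx => ?_⟩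
  rw [fun_iteratedFDeriv_add_apply (f := fun u => G (τ u)) (g := fun u => Λ u)
    (hGk.comp τ.contDiff).contDiffAt Λ.contDiff.contDiffAt]
  exact (norm_add_le _ _).trans (add_le_add (h1 x hx) (hB₂ x hx))

/-- The components of the test problems: time and its integral, a driven family, and
an observing family. -/
abbrev TestIndex : Type := Fin 2 ⊕ ℕ ⊕ ℕ

/-- The eigenvalues of the test problems: zero, `y (k + 1) ^ 2` and `x (k + 1) ^ 2`. -/
def testEigenvalue (x y : ℝ) : TestIndex → ℝ :=
  Sum.elim (fun _ => 0) (Sum.elim (fun k => y * (k + 1) ^ 2) (fun k => x * (k + 1) ^ 2))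

theorem testEigenvalue_nonpos {x y : ℝ} (hx : x < 0) (hy : y < 0) (n : TestIndex) :
    testEigenvalue x y n ≤ 0 := by
  rcases n with n | n | n
  · exact le_rfl
  · exact mul_nonpos_of_nonpos_of_nonneg hy.le (by positivity)
  · exact mul_nonpos_of_nonpos_of_nonneg hx.le (by positivity)

/-- The embedding of sequences as driven families. -/
noncomputable def drivenVec : C₀(ℕ, ℂ) →L[ℂ] C₀(TestIndex, ℂ) :=
  c0Pull (Sum.elim (fun _ => none) (Sum.elim some fun _ => none)) (by
    rintro (n | n | n) (n' | n' | n') k <;> (simp; try omega))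

/-- The map that feeds the driven family into the observing family. -/
noncomputable def observe : C₀(TestIndex, ℂ) →L[ℂ] C₀(TestIndex, ℂ) :=
  c0Pull (Sum.elim (fun _ => none) (Sum.elim (fun _ => none) fun k => some (Sum.inr (Sum.inl k))))
    (by rintro (n | n | n) (n' | n' | n') k <;> (simp; try grind))

@[simp] theorem drivenVec_inl (x : C₀(ℕ, ℂ)) (n : Fin 2) : drivenVec x (Sum.inl n) = 0 := rfl
@[simp] theorem drivenVec_inr_inl (x : C₀(ℕ, ℂ)) (k : ℕ) :
    drivenVec x (Sum.inr (Sum.inl k)) = x k := rfl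
@[simp] theorem drivenVec_inr_inr (x : C₀(ℕ, ℂ)) (k : ℕ) :
    drivenVec x (Sum.inr (Sum.inr k)) = 0 := rfl
@[simp] theorem observe_inl (x : C₀(TestIndex, ℂ)) (n : Fin 2) : observe x (Sum.inl n) = 0 := rfl
@[simp] theorem observe_inr_inl (x : C₀(TestIndex, ℂ)) (k : ℕ) :
    observe x (Sum.inr (Sum.inl k)) = 0 := rfl
@[simp] theorem observe_inr_inr (x : C₀(TestIndex, ℂ)) (k : ℕ) :
    observe x (Sum.inr (Sum.inr k)) = x (Sum.inr (Sum.inl k)) := rfl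

/-- The exact solution of the test problem. -/
noncomputable def testSolution (p : ℕ) (w : C₀(ℕ, ℂ)) (t : ℝ) : C₀(TestIndex, ℂ) :=
  t • c0Single (Sum.inl 0) + (t ^ 2 / 2) • c0Single (Sum.inl 1) +
    (t ^ p / p.factorial) • drivenVec w

/-- The time-dependent part of the nonlinearity of the test problem. -/
noncomputable def testForcing (p : ℕ) (w v e : C₀(ℕ, ℂ)) (z : ℂ) : C₀(TestIndex, ℂ) :=
  c0Single (Sum.inl 0) + z • c0Single (Sum.inl 1) +
    (z ^ (p - 1) / ((p - 1).factorial : ℂ)) • drivenVec w -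
    (z ^ p / (p.factorial : ℂ)) • drivenVec v + (z ^ 2 / 2) • drivenVec e -
    (z ^ p / (p.factorial : ℂ)) • observe (drivenVec w)

/-- The linear part of the nonlinearity of the test problem. -/
noncomputable def testLinear (e : C₀(ℕ, ℂ)) : C₀(TestIndex, ℂ) →L[ℂ] C₀(TestIndex, ℂ) :=
  observe - (c0Eval (Sum.inl 1)).smulRight (drivenVec e)

theorem contDiff_testForcing (p : ℕ) (w v e : C₀(ℕ, ℂ)) :
    ContDiff ℂ ∞ (testForcing p w v e) := by
  unfold testForcing
  fun_prop

theorem hasDerivAt_testSolution (p : ℕ) (w : C₀(ℕ, ℂ)) (t : ℝ) :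
    HasDerivAt (testSolution (p + 1) w) (c0Single (Sum.inl 0) + t • c0Single (Sum.inl 1) +
      (t ^ p / p.factorial) • drivenVec w) t := by
  have h1 : HasDerivAt (fun t : ℝ => t ^ 2 / 2) t t := by
    simpa using (hasDerivAt_pow 2 t).div_const 2
  have h2 : HasDerivAt (fun t : ℝ => t ^ (p + 1) / (p + 1).factorial) (t ^ p / p.factorial) t := by
    convert! (hasDerivAt_pow (p + 1) t).div_const ((p + 1).factorial : ℝ) using 1
    rw [Nat.factorial_succ]
    push_cast
    field_simp
  convert! (((hasDerivAt_id t).smul_const (c0Single (Sum.inl 0) : C₀(TestIndex, ℂ))).add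
    (h1.smul_const (c0Single (Sum.inl 1)))).add (h2.smul_const (drivenVec w)) using 1
  simp

/-- A diagonal problem whose exact solution is polynomial: the driven family is `t ^ p / p! w`, and
the observing family vanishes. -/
noncomputable def testProblem {x y : ℝ} (hx : x < 0) (hy : y < 0) (p : ℕ) (w v e : C₀(ℕ, ℂ))
    (hv : ∀ k, v k = ((y * (k + 1) ^ 2 : ℝ) : ℂ) * w k) : ParabolicProblem C₀(TestIndex, ℂ) where
  A := diagGenerator (testEigenvalue x y)
  S := diagSemigroup (testEigenvalue x y) (testEigenvalue_nonpos hx hy)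
  g u := testForcing (p + 1) w v e (c0Eval (Sum.inl 0) u) + testLinear e u
  t₀ := 0
  T := 1
  u := testSolution (p + 1) w
  lt := zero_lt_one
  analytic := isAnalyticSemigroup_diagSemigroup
  generator := isGenerator_diagGenerator
  smooth_u := by
    unfold testSolution
    fun_prop
  solution t ht := by
    rw [mem_graph_diagGenerator, (hasDerivAt_testSolution p w t).hasDerivWithinAt.derivWithin
      (uniqueDiffOn_Icc zero_lt_one t ht)]
    rintro (n | n | n)
    · fin_cases n <;>
        simp [testForcing, testLinear, testSolution, testEigenvalue, c0Single_apply]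
    · simp [testForcing, testLinear, testSolution, testEigenvalue, c0Single_apply, hv]
      ring
    · simp [testForcing, testLinear, testSolution, testEigenvalue, c0Single_apply]
  smooth_g := by
    refine ⟨1, one_pos, ContDiff.contDiffOn ?_, fun k =>
      exists_bound_iteratedFDeriv (contDiff_testForcing _ _ _ _) _ _ ?_ k⟩
    · exact ((contDiff_testForcing _ _ _ _).comp (c0Eval _).contDiff).add (testLinear e).contDiff
    · refine Bornology.IsBounded.thickening (IsCompact.isBounded ?_)
      refine isCompact_Icc.image_of_continuousOn fun t _ => ?_
      exact (hasDerivAt_testSolution p w t).continuousAt.continuousWithinAt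

/-! ### The one-step error of the test problems -/

/-- The defect of order `j` of a row of coefficients `α` with node `γ`; it vanishes for `j ≤ 1`
because the methods treat constant forcing exactly. -/
noncomputable def rowDefect (c : ℕ → ℂ) (s : Finset ℕ) (α : ℕ → ℂ) (γ z : ℂ) (j : ℕ) : ℂ :=
  if j ≤ 1 then 0
  else (∑ k ∈ s, c k ^ (j - 1) / ((j - 1).factorial : ℂ) * α k) - γ ^ j * phi j (γ * z)

/-- Common error formula for stages and for the step, started from 0. The forcing w t^p/p! - v
t^(p+1)/(p+1)! has exact response w t^(p+1)/(p+1)!, and `mul_phi_succ` turns the quadrature error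
into two consecutive defects. For p = 0 the constant forcing contributes no defect. -/
theorem rowDefect_error (c : ℕ → ℂ) (s : Finset ℕ) (α q : ℕ → ℂ)
    (γ z h w v e : ℂ) (hv : h * v = z * w) (p : ℕ) :
    γ * h * (phi 1 (γ * z) * (0 ^ p / (p.factorial : ℂ) * w)) +
      h * ∑ j ∈ s, α j * ((c j * h) ^ p / (p.factorial : ℂ) * w -
        (c j * h) ^ (p + 1) / ((p + 1).factorial : ℂ) * v - h ^ 2 * q j * e -
        0 ^ p / (p.factorial : ℂ) * w) -
      (γ * h) ^ (p + 1) / ((p + 1).factorial : ℂ) * w =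
    h ^ (p + 1) * w * (rowDefect c s α γ z (p + 1) - z * rowDefect c s α γ z (p + 2)) -
      h ^ 3 * e * ∑ j ∈ s, α j * q j := by
  have hs1 : ∀ q : ℕ, ∑ k ∈ s, c k ^ q / (q.factorial : ℂ) * α k =
      (∑ k ∈ s, α k * c k ^ q) / (q.factorial : ℂ) := fun q => by
    rw [Finset.sum_div]
    exact Finset.sum_congr rfl fun i _ => by ring
  have hs2 : ∑ j ∈ s, α j * ((c j * h) ^ p / (p.factorial : ℂ) * w -
      (c j * h) ^ (p + 1) / ((p + 1).factorial : ℂ) * v - h ^ 2 * q j * e -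
      0 ^ p / (p.factorial : ℂ) * w) =
      (∑ k ∈ s, α k * c k ^ p) * h ^ p / (p.factorial : ℂ) * w -
      (∑ k ∈ s, α k * c k ^ (p + 1)) * h ^ (p + 1) / ((p + 1).factorial : ℂ) * v -
      (∑ k ∈ s, α k * q k) * (h ^ 2 * e) - (∑ k ∈ s, α k) * (0 ^ p / (p.factorial : ℂ) * w) := by
    simp only [Finset.sum_mul, Finset.sum_div]
    rw [← Finset.sum_sub_distrib, ← Finset.sum_sub_distrib, ← Finset.sum_sub_distrib]
    exact Finset.sum_congr rfl fun i _ => by ring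
  rw [hs2]
  rcases p with _ | p
  · have h1 := mul_phi_succ 1 (γ * z)
    simp only [rowDefect, hs1]
    simp at h1 ⊢
    linear_combination -(h * (∑ x ∈ s, α x * c x)) * hv + γ * h * w * (-h1)
  · have h1 := mul_phi_succ (p + 2) (γ * z)
    have e : p + 1 + 1 = p + 2 := rfl
    have e' : p + 1 + 2 = p + 3 := rfl
    have e3 : ¬ p + 2 ≤ 1 := by omega
    have e4 : ¬ p + 3 ≤ 1 := by omega
    simp only [e, e', rowDefect, hs1, if_neg e3, if_neg e4,
      show p + 2 - 1 = p + 1 from rfl, show p + 3 - 1 = p + 2 from rfl]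
    rw [zero_pow p.succ_ne_zero]
    simp only [div_eq_mul_inv, one_mul] at h1 ⊢
    linear_combination
      (-(h ^ (p + 2) * (∑ k ∈ s, α k * c k ^ (p + 2)) * ((p + 2).factorial : ℂ)⁻¹)) * hv +
        (h ^ (p + 2) * w * γ ^ (p + 2)) * (-h1)

section TestStep

variable {x y : ℝ} (hx : x < 0) (hy : y < 0) (p : ℕ) (w v e : C₀(ℕ, ℂ))
  (hv : ∀ k, v k = ((y * (k + 1) ^ 2 : ℝ) : ℂ) * w k) (m : Method) {h : ℝ}

theorem testProblem_g_time (u : C₀(TestIndex, ℂ)) :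
    (testProblem hx hy p w v e hv).g u (Sum.inl 0) = 1 := by
  simp [testProblem, testForcing, testLinear, c0Single_apply]

theorem testProblem_g_integral (u : C₀(TestIndex, ℂ)) :
    (testProblem hx hy p w v e hv).g u (Sum.inl 1) = u (Sum.inl 0) := by
  simp [testProblem, testForcing, testLinear, c0Single_apply]

theorem testProblem_g_driven (u : C₀(TestIndex, ℂ)) (k : ℕ) :
    (testProblem hx hy p w v e hv).g u (Sum.inr (Sum.inl k)) =
      u (Sum.inl 0) ^ p / (p.factorial : ℂ) * w k -
      u (Sum.inl 0) ^ (p + 1) / ((p + 1).factorial : ℂ) * v k +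
      (u (Sum.inl 0) ^ 2 / 2 - u (Sum.inl 1)) * e k := by
  simp [testProblem, testForcing, testLinear, c0Single_apply]
  ring

theorem testProblem_g_observing (u : C₀(TestIndex, ℂ)) (k : ℕ) :
    (testProblem hx hy p w v e hv).g u (Sum.inr (Sum.inr k)) =
      u (Sum.inr (Sum.inl k)) - u (Sum.inl 0) ^ (p + 1) / ((p + 1).factorial : ℂ) * w k := by
  simp [testProblem, testForcing, testLinear, c0Single_apply]
  ring

theorem testProblem_stage_time (hh : 0 ≤ h) (i : ℕ) :
    m.stage (testProblem hx hy p w v e hv) h 0 i (Sum.inl 0) = m.node i * h := by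
  rw [stage_apply m (P := testProblem hx hy p w v e hv) rfl hh]
  simp [testProblem_g_time, testEigenvalue, phi_apply_zero]

theorem testProblem_stage_integral (hh : 0 ≤ h) (i : ℕ) :
    m.stage (testProblem hx hy p w v e hv) h 0 i (Sum.inl 1) =
      h ^ 2 * ∑ j ∈ Finset.Ico 2 i, (m.a i j).val 0 * m.node j := by
  rw [stage_apply m (P := testProblem hx hy p w v e hv) rfl hh]
  simp only [testProblem_g_integral, testProblem_stage_time hx hy p w v e hv m hh]
  simp only [testEigenvalue, Sum.elim_inl, ZeroAtInftyContinuousMap.zero_apply,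
    Complex.ofReal_zero, mul_zero, zero_add, sub_zero, Finset.mul_sum]
  exact Finset.sum_congr rfl fun j _ => by ring

/-- The e-term multiplies τ²/2 - σ, with τ the time component and σ its integral. It vanishes on the
exact solution, but at a stage it equals -h² ψ_{2,i}(0), which injects ψ_2 at argument 0 into the
driven family. -/
theorem testProblem_g_stage (hh : 0 ≤ h) (i k : ℕ) :
    (testProblem hx hy p w v e hv).g (m.stage (testProblem hx hy p w v e hv) h 0 i)
      (Sum.inr (Sum.inl k)) = (m.node i * h) ^ p / (p.factorial : ℂ) * w k -
      (m.node i * h) ^ (p + 1) / ((p + 1).factorial : ℂ) * v k -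
      h ^ 2 * scalarPsi m.node (fun i k => (m.a i k).val) 2 i 0 * e k := by
  rw [testProblem_g_driven, testProblem_stage_time hx hy p w v e hv m hh,
    testProblem_stage_integral hx hy p w v e hv m hh]
  simp only [scalarPsi, mul_zero, phi_apply_zero]
  have : ∑ j ∈ Finset.Ico 2 i, m.node j ^ (2 - 1) / ((2 - 1).factorial : ℂ) * (m.a i j).val 0 =
      ∑ j ∈ Finset.Ico 2 i, (m.a i j).val 0 * m.node j :=
    Finset.sum_congr rfl fun j _ => by simp [mul_comm]
  rw [this, Nat.factorial_two]
  push_cast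
  ring

theorem testProblem_g_zero (k : ℕ) :
    (testProblem hx hy p w v e hv).g 0 (Sum.inr (Sum.inl k)) =
      0 ^ p / (p.factorial : ℂ) * w k := by
  rw [testProblem_g_driven]
  simp

theorem testProblem_stage_driven (hh : 0 ≤ h) (i k : ℕ) {z : ℂ}
    (hz : z = h * (y * (k + 1) ^ 2 : ℝ)) :
    m.stage (testProblem hx hy p w v e hv) h 0 i (Sum.inr (Sum.inl k)) -
      (m.node i * h) ^ (p + 1) / ((p + 1).factorial : ℂ) * w k =
    h ^ (p + 1) * w k *
      (rowDefect m.node (Finset.Ico 2 i) (fun j => (m.a i j).val z) (m.node i) z (p + 1) -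
        z * rowDefect m.node (Finset.Ico 2 i) (fun j => (m.a i j).val z) (m.node i) z (p + 2)) -
    h ^ 3 * e k * ∑ j ∈ Finset.Ico 2 i,
      (m.a i j).val z * scalarPsi m.node (fun i k => (m.a i k).val) 2 j 0 := by
  rw [← rowDefect_error m.node (Finset.Ico 2 i) _ _ (m.node i) z h (w k) (v k) (e k)
    (by rw [hv, hz]; ring) p, stage_apply m (P := testProblem hx hy p w v e hv) rfl hh]
  have hz' : (h : ℂ) * (testEigenvalue x y (Sum.inr (Sum.inl k)) : ℝ) = z := by
    rw [hz]; rfl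
  simp only [testProblem_g_stage hx hy p w v e hv m hh, testProblem_g_zero, hz',
    ZeroAtInftyContinuousMap.zero_apply, mul_zero, zero_add]

theorem testProblem_step_driven (hh : 0 ≤ h) (s k : ℕ) {z : ℂ}
    (hz : z = h * (y * (k + 1) ^ 2 : ℝ)) :
    m.step s (testProblem hx hy p w v e hv) h 0 (Sum.inr (Sum.inl k)) -
      (h : ℂ) ^ (p + 1) / ((p + 1).factorial : ℂ) * w k =
    h ^ (p + 1) * w k *
      (rowDefect m.node (Finset.Icc 2 s) (fun j => (m.b j).val z) 1 z (p + 1) -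
        z * rowDefect m.node (Finset.Icc 2 s) (fun j => (m.b j).val z) 1 z (p + 2)) -
    h ^ 3 * e k * ∑ j ∈ Finset.Icc 2 s,
      (m.b j).val z * scalarPsi m.node (fun i k => (m.a i k).val) 2 j 0 := by
  rw [← rowDefect_error m.node (Finset.Icc 2 s) _ _ 1 z h (w k) (v k) (e k)
    (by rw [hv, hz]; ring) p, step_apply m s (P := testProblem hx hy p w v e hv) rfl hh]
  have hz' : (h : ℂ) * (testEigenvalue x y (Sum.inr (Sum.inl k)) : ℝ) = z := by
    rw [hz]; rfl
  simp only [testProblem_g_stage hx hy p w v e hv m hh, testProblem_g_zero, hz',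
    ZeroAtInftyContinuousMap.zero_apply, mul_zero, zero_add, one_mul]

theorem testProblem_step_observing (hh : 0 ≤ h) (s k : ℕ) {z z' : ℂ}
    (hz : z = h * (y * (k + 1) ^ 2 : ℝ)) (hz' : z' = h * (x * (k + 1) ^ 2 : ℝ)) :
    m.step s (testProblem hx hy p w v e hv) h 0 (Sum.inr (Sum.inr k)) =
    h * ∑ i ∈ Finset.Icc 2 s, (m.b i).val z' * (h ^ (p + 1) * w k *
      (rowDefect m.node (Finset.Ico 2 i) (fun j => (m.a i j).val z) (m.node i) z (p + 1) -
        z * rowDefect m.node (Finset.Ico 2 i) (fun j => (m.a i j).val z) (m.node i) z (p + 2)) -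
    h ^ 3 * e k * ∑ j ∈ Finset.Ico 2 i,
      (m.a i j).val z * scalarPsi m.node (fun i k => (m.a i k).val) 2 j 0) := by
  rw [step_apply m s (P := testProblem hx hy p w v e hv) rfl hh]
  have hz'' : (h : ℂ) * (testEigenvalue x y (Sum.inr (Sum.inr k)) : ℝ) = z' := by
    rw [hz']; rfl
  simp only [testProblem_g_observing, testProblem_stage_time hx hy p w v e hv m hh,
    testProblem_stage_driven hx hy p w v e hv m hh _ k hz, hz'',
    ZeroAtInftyContinuousMap.zero_apply, zero_pow p.succ_ne_zero, zero_div, zero_mul, sub_zero,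
    mul_zero, zero_add]

/-- The bounds that convergence of order five imposes on a single step of the test problem. -/
theorem testProblem_bounds {s : ℕ} (hm : m.ConvergentOfOrder s 5) :
    ∃ C : ℝ, ∀ᶠ k : ℕ in Filter.atTop, ∀ n,
      ‖m.step s (testProblem hx hy p w v e hv) (((k : ℝ) + 1) ^ 2)⁻¹ 0 n -
        testSolution (p + 1) w (((k : ℝ) + 1) ^ 2)⁻¹ n‖ ≤ C * ((((k : ℝ) + 1) ^ 2)⁻¹) ^ 5 := by
  obtain ⟨C, h₀, hh₀, hC⟩ := hm C₀(TestIndex, ℂ) (testProblem hx hy p w v e hv)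
  refine ⟨C, ?_⟩
  have ht : Filter.Tendsto (fun k : ℕ => (((k : ℝ) + 1) ^ 2)⁻¹) Filter.atTop (𝓝 0) := by
    refine tendsto_inv_atTop_zero.comp ((Filter.tendsto_pow_atTop two_ne_zero).comp ?_)
    exact Filter.tendsto_atTop_add_const_right _ _ tendsto_natCast_atTop_atTop
  filter_upwards [ht.eventually (gt_mem_nhds hh₀)] with k hk n
  have hpos : 0 < (((k : ℝ) + 1) ^ 2)⁻¹ := by positivity
  have hle : (((k : ℝ) + 1) ^ 2)⁻¹ ≤ 1 :=
    inv_le_one_of_one_le₀ (one_le_pow₀ (by linarith [k.cast_nonneg (α := ℝ)]))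
  -- One step from exact data suffices: the global bound with n = 1 is a local error bound.
  have h1 := hC _ hpos hk.le 1 (by simpa [testProblem] using hle)
  have h0 : testSolution (p + 1) w 0 = 0 := by simp [testSolution]
  refine (c0_norm_apply_le (m.step s (testProblem hx hy p w v e hv) (((k : ℝ) + 1) ^ 2)⁻¹ 0 -
    testSolution (p + 1) w (((k : ℝ) + 1) ^ 2)⁻¹) n).trans ?_
  simpa [Method.numSol, testProblem, h0] using h1

end TestStep

/-! ### From convergence to the scalar order conditions -/

/-- The null sequence `(k + 1)⁻¹ ^ (q + 1)`. -/
noncomputable def invPowSeq (q : ℕ) : C₀(ℕ, ℂ) where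
  toFun k := (((k : ℝ) + 1)⁻¹ ^ (q + 1) : ℝ)
  continuous_toFun := continuous_of_discreteTopology
  zero_at_infty' := by
    rw [Filter.cocompact_eq_cofinite, Nat.cofinite_eq_atTop]
    have h : Filter.Tendsto (fun k : ℕ => (((k : ℝ) + 1)⁻¹) ^ (q + 1)) Filter.atTop (𝓝 0) := by
      have := (tendsto_inv_atTop_zero.comp (Filter.tendsto_atTop_add_const_right _ (1 : ℝ)
        (tendsto_natCast_atTop_atTop (R := ℝ)))).pow (q + 1)
      simpa using this
    exact (Complex.continuous_ofReal.tendsto' 0 0 (by simp)).comp h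

theorem invPowSeq_apply (q k : ℕ) : invPowSeq q k = (((k : ℝ) + 1)⁻¹ ^ (q + 1) : ℝ) := rfl

/-- With h = (k+1)⁻² and q ≤ 4 the bound leaves |Q| ≤ C h (k+1) = C/(k+1), which tends to zero. -/
theorem eq_zero_of_eventually_norm_le {Q : ℂ} {C : ℝ} {q : ℕ} (hq : q ≤ 4)
    (h : ∀ᶠ k : ℕ in Filter.atTop, ‖((((k : ℝ) + 1) ^ 2)⁻¹ : ℝ) ^ q * invPowSeq 0 k * Q‖ ≤
      C * ((((k : ℝ) + 1) ^ 2)⁻¹) ^ 5) : Q = 0 := by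
  have ht : Filter.Tendsto (fun k : ℕ => C * ((k : ℝ) + 1)⁻¹) Filter.atTop (𝓝 (C * 0)) :=
    (tendsto_inv_atTop_zero.comp (Filter.tendsto_atTop_add_const_right _ (1 : ℝ)
        (tendsto_natCast_atTop_atTop (R := ℝ)))).const_mul C
  rw [mul_zero] at ht
  refine norm_le_zero_iff.mp (ge_of_tendsto ht ?_)
  filter_upwards [h] with k hk
  set ε : ℝ := ((k : ℝ) + 1)⁻¹ with hε
  have hε0 : 0 < ε := by positivity
  have hε1 : ε ≤ 1 := inv_le_one_of_one_le₀ (by linarith [k.cast_nonneg (α := ℝ)])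
  rw [invPowSeq_apply, ← hε, ← inv_pow, ← hε, norm_mul, norm_mul, ← Complex.ofReal_pow,
    Complex.norm_real, Complex.norm_real, Real.norm_of_nonneg (by positivity),
    Real.norm_of_nonneg (by positivity)] at hk
  have h4 : (ε ^ 2) ^ 4 ≤ (ε ^ 2) ^ q := pow_le_pow_of_le_one (by positivity)
    (pow_le_one₀ hε0.le hε1) hq
  have h5 : (ε ^ 2) ^ 4 * ε ^ (0 + 1) * ‖Q‖ ≤ C * (ε ^ 2) ^ 5 := le_trans (by gcongr) hk
  have h6 : ε ^ 9 * ‖Q‖ ≤ ε ^ 9 * (C * ε) := by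
    calc ε ^ 9 * ‖Q‖ = (ε ^ 2) ^ 4 * ε ^ (0 + 1) * ‖Q‖ := by ring
      _ ≤ C * (ε ^ 2) ^ 5 := h5
      _ = ε ^ 9 * (C * ε) := by ring
  exact le_of_mul_le_mul_left h6 (by positivity)

theorem smul_invPowSeq_zero (y : ℝ) (k : ℕ) :
    (y • invPowSeq 0) k = ((y * (k + 1) ^ 2 : ℝ) : ℂ) * invPowSeq 2 k := by
  have : (k : ℂ) + 1 ≠ 0 := by exact_mod_cast k.succ_ne_zero
  simp only [ZeroAtInftyContinuousMap.smul_apply, invPowSeq_apply, Complex.real_smul]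
  push_cast
  field_simp

theorem invPowSeq_two (k : ℕ) :
    invPowSeq 2 k = ((((k : ℝ) + 1) ^ 2)⁻¹ : ℝ) * invPowSeq 0 k := by
  simp only [invPowSeq_apply]
  push_cast
  field_simp

section Necessary

variable {m : Method} {s : ℕ} {x y : ℝ}

theorem stepsize_mul (y : ℝ) (k : ℕ) :
    (y : ℂ) = ((((k : ℝ) + 1) ^ 2)⁻¹ : ℝ) * (y * (k + 1) ^ 2 : ℝ) := by
  have : (k : ℂ) + 1 ≠ 0 := by exact_mod_cast k.succ_ne_zero
  push_cast
  field_simp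

/-- The choice w_k = (k+1)⁻³ keeps v = Aw a null sequence. Since w_k = h/(k+1), the driven error has
size h^(p+2)/(k+1), whence p ≤ 2. -/
theorem driven_defect (hm : m.ConvergentOfOrder s 5) (hx : x < 0) {p : ℕ} (hp : p ≤ 2) :
    rowDefect m.node (Finset.Icc 2 s) (fun j => (m.b j).val x) 1 x (p + 1) -
      x * rowDefect m.node (Finset.Icc 2 s) (fun j => (m.b j).val x) 1 x (p + 2) = 0 := by
  obtain ⟨C, hC⟩ := testProblem_bounds hx hx p (invPowSeq 2) (x • invPowSeq 0) 0
    (smul_invPowSeq_zero x) m hm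
  refine eq_zero_of_eventually_norm_le (C := C) (q := p + 2) (by omega) ?_
  filter_upwards [hC] with k hk
  refine le_of_eq_of_le (congrArg norm ?_) (hk (Sum.inr (Sum.inl k)))
  have e : testSolution (p + 1) (invPowSeq 2) (((k : ℝ) + 1) ^ 2)⁻¹ (Sum.inr (Sum.inl k)) =
      (((((k : ℝ) + 1) ^ 2)⁻¹ : ℝ) : ℂ) ^ (p + 1) / ((p + 1).factorial : ℂ) * invPowSeq 2 k := by
    simp [testSolution, c0Single_apply]
  rw [e, testProblem_step_driven hx hx p _ _ _ (smul_invPowSeq_zero x) m (by positivity) s k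
    (stepsize_mul x k), invPowSeq_two, ZeroAtInftyContinuousMap.zero_apply]
  ring

/-- The observing family sees the stage errors of the driven family through b_i at its own argument
x, at the price of one more factor h; hence p ≤ 1. -/
theorem observing_defect (hm : m.ConvergentOfOrder s 5) (hx : x < 0) (hy : y < 0) {p : ℕ}
    (hp : p ≤ 1) :
    ∑ i ∈ Finset.Icc 2 s, (m.b i).val x *
      (rowDefect m.node (Finset.Ico 2 i) (fun j => (m.a i j).val y) (m.node i) y (p + 1) -
        y * rowDefect m.node (Finset.Ico 2 i) (fun j => (m.a i j).val y) (m.node i) y (p + 2)) =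
      0 := by
  obtain ⟨C, hC⟩ := testProblem_bounds hx hy p (invPowSeq 2) (y • invPowSeq 0) 0
    (smul_invPowSeq_zero y) m hm
  refine eq_zero_of_eventually_norm_le (C := C) (q := p + 3) (by omega) ?_
  filter_upwards [hC] with k hk
  refine le_of_eq_of_le (congrArg norm ?_) (hk (Sum.inr (Sum.inr k)))
  have e : testSolution (p + 1) (invPowSeq 2) (((k : ℝ) + 1) ^ 2)⁻¹ (Sum.inr (Sum.inr k)) = 0 := by
    simp [testSolution, c0Single_apply]
  rw [e, testProblem_step_observing hx hy p _ _ _ (smul_invPowSeq_zero y) m (by positivity) s k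
    (stepsize_mul y k) (stepsize_mul x k), invPowSeq_two, ZeroAtInftyContinuousMap.zero_apply]
  simp only [Finset.mul_sum, mul_zero, zero_mul, Finset.sum_const_zero, sub_zero]
  exact Finset.sum_congr rfl fun i _ => by ring

/-- With w = 0 only the e-term survives: ψ_2(0) passes through a_ij(y) and b_i(x), with total weight
h⁴/(k+1). -/
theorem nested_defect (hm : m.ConvergentOfOrder s 5) (hx : x < 0) (hy : y < 0) :
    ∑ i ∈ Finset.Icc 2 s, (m.b i).val x * ∑ j ∈ Finset.Ico 2 i,
      (m.a i j).val y * scalarPsi m.node (fun i k => (m.a i k).val) 2 j 0 = 0 := by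
  obtain ⟨C, hC⟩ := testProblem_bounds hx hy 0 0 0 (-invPowSeq 0) (by simp) m hm
  refine eq_zero_of_eventually_norm_le (C := C) (q := 4) le_rfl ?_
  filter_upwards [hC] with k hk
  refine le_of_eq_of_le (congrArg norm ?_) (hk (Sum.inr (Sum.inr k)))
  have e : testSolution (0 + 1) 0 (((k : ℝ) + 1) ^ 2)⁻¹ (Sum.inr (Sum.inr k)) = 0 := by
    simp [testSolution, c0Single_apply]
  rw [e, testProblem_step_observing hx hy 0 _ _ _ (by simp) m (by positivity) s k
    (stepsize_mul y k) (stepsize_mul x k), ZeroAtInftyContinuousMap.zero_apply,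
    ZeroAtInftyContinuousMap.neg_apply]
  simp only [mul_zero, zero_mul, sub_zero, zero_sub]
  rw [Finset.mul_sum, Finset.mul_sum]
  exact Finset.sum_congr rfl fun i _ => by ring

/-- Convergence of order five for parabolic problems implies the scalar order conditions. -/
theorem Method.ConvergentOfOrder.scalarConditions (hm : m.ConvergentOfOrder s 5) :
    ScalarConditions m.node (fun i k => (m.a i k).val) (fun i => (m.b i).val) s where
  quadrature k hk x hx := by
    have hx0 : (x : ℂ) ≠ 0 := by exact_mod_cast hx.ne
    -- Each relation couples consecutive defects; the chain starts from the zero defect of order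
    -- one, and x ≠ 0 allows division.
    have key : ∀ p ≤ 2, rowDefect m.node (Finset.Icc 2 s) (fun j => (m.b j).val x) 1 x (p + 2) =
        0 := by
      intro p
      induction p with
      | zero =>
        intro hp
        have := driven_defect hm hx hp
        rw [rowDefect, if_pos le_rfl, zero_sub, neg_eq_zero] at this
        exact (mul_eq_zero.mp this).resolve_left hx0
      | succ p ih =>
        intro hp
        have := driven_defect hm hx hp
        rw [show p + 1 + 1 = p + 2 from rfl, ih (by omega), zero_sub, neg_eq_zero] at this
        exact (mul_eq_zero.mp this).resolve_left hx0
    obtain ⟨p, rfl⟩ : ∃ p, k = p + 1 := ⟨k - 1, by have := (Finset.mem_Icc.mp hk).1; omega⟩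
    have := key p (by have := (Finset.mem_Icc.mp hk).2; omega)
    rw [rowDefect, if_neg (by omega), one_pow, one_mul, one_mul, sub_eq_zero] at this
    rw [show p + 1 + 1 = p + 2 from rfl, ← this]
    exact Finset.sum_congr rfl fun i _ => mul_comm _ _
  stages j hj x y hx hy := by
    have hy0 : (y : ℂ) ≠ 0 := by exact_mod_cast hy.ne
    have e : ∀ i j, rowDefect m.node (Finset.Ico 2 i) (fun j => (m.a i j).val y) (m.node i) y
        (j + 2) = scalarPsi m.node (fun i k => (m.a i k).val) (j + 2) i y := fun i j => by
      rw [rowDefect, if_neg (by omega)]; rfl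
    have h2 : ∑ i ∈ Finset.Icc 2 s, (m.b i).val x *
        scalarPsi m.node (fun i k => (m.a i k).val) 2 i y = 0 := by
      have h := observing_defect hm hx hy (p := 0) (by omega)
      simp only [zero_add, e] at h
      have h' : (-y : ℂ) * ∑ i ∈ Finset.Icc 2 s, (m.b i).val x *
          scalarPsi m.node (fun i k => (m.a i k).val) 2 i y = 0 := by
        rw [← h, Finset.mul_sum]
        refine Finset.sum_congr rfl fun i _ => ?_
        rw [rowDefect, if_pos le_rfl, ← e]
        ring
      exact (mul_eq_zero.mp h').resolve_left (neg_ne_zero.mpr hy0)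
    have h3 : ∑ i ∈ Finset.Icc 2 s, (m.b i).val x *
        scalarPsi m.node (fun i k => (m.a i k).val) 3 i y = 0 := by
      have h := observing_defect hm hx hy (p := 1) le_rfl
      simp only [mul_sub, Finset.sum_sub_distrib, show 1 + 1 = 0 + 2 from rfl, e] at h
      rw [zero_add, h2, zero_sub, neg_eq_zero] at h
      have h' : (y : ℂ) * ∑ i ∈ Finset.Icc 2 s, (m.b i).val x *
          scalarPsi m.node (fun i k => (m.a i k).val) 3 i y = 0 := by
        rw [← h, Finset.mul_sum]
        exact Finset.sum_congr rfl fun i _ => mul_left_comm _ _ _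
      exact (mul_eq_zero.mp h').resolve_left hy0
    obtain ⟨hj2, hj3⟩ := Finset.mem_Icc.mp hj
    interval_cases j
    · exact h2
    · exact h3
  nested x y hx hy := nested_defect hm hx hy

end Necessary

end ExpRK

theorem theorem5p1 (s : ℕ) (hs : s ≤ 6) :
    (¬ ∃ m : ExpRK.Method, m.ConvergentOfOrder s 5) ∧
      (¬ ∃ m : ExpRK.Method, m.StiffOrderFour s) :=
  ⟨fun ⟨_, hm⟩ => ExpRK.not_scalarConditions hs hm.scalarConditions,
    fun ⟨_, hm⟩ => ExpRK.not_scalarConditions hs hm.scalarConditions⟩
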